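/- Let $p\ge 5$ be a prime and let $R_p=\widehat{\mathbb Z}_p^{ur}=W(\overline{\mathbb F}_p)$ be the completion of the maximal unramified extension of $\mathbb Z_p$, with its Frobenius lift $\phi$. Let $\pi$ be a root of an Eisenstein polynomial of degree $e\ge 2$ over $\mathbb Z_p$, let $R_\pi=R_p[\pi]=R_p\otimes_{\mathbb Z_p}\mathbb Z_p[\pi]$, extend $\phi$ to $R_\pi$ by $\phi(\pi)=\pi$, and let $v_p$ be the valuation on $R_\pi$ with $v_p(p)=1$. Write $\hat{\ }$ for $p$-adic completion. A $p$-derivation from a ring $A$ to an $A$-algebra $B$ is a map $\delta_p:A\to B$ with $\delta_p(1)=0$, $\delta_p(x+y)=\delta_px+\delta_py+\frac{x^p+y^p-(x+y)^p}{p}$ and $\delta_p(xy)=x^p\delta_py+y^p\delta_px+p\,\delta_px\,\delta_py$; then $\phi(x)=x^p+p\,\delta_px$ is a ring homomorphism. A $\delta_p$-prolongation sequence is a sequence of rings $A^0\to A^1\to\cdots$ with compatible $p$-derivations $\delta_p:A^n\to A^{n+1}$. Replacing $p$ by $\pi$ as the denominator, one defines $\pi$-derivations $\delta_\pi$ (with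 $\phi(x)=x^p+\pi\,\delta_\pi x$) and $\delta_\pi$-prolongation sequences. These sequences are taken over $R_p$, respectively $R_\pi$, equipped with $\delta_px=(\phi(x)-x^p)/p$, respectively $\delta_\pi x=(\phi(x)-x^p)/\pi$. Let $X=\mathrm{Spec}\,S$ be a smooth affine $R_p$-scheme and $r\ge 1$. Let $S^r_p=\mathcal O(J^r_p(X))$ be the $p$-adic completion of the $r$-th term of the universal $\delta_p$-prolongation sequence starting with $S$, and let $S^r_\pi=\mathcal O(J^r_\pi(X_{R_\pi}))$ be the $p$-adic completion of the $r$-th term of the universal $\delta_\pi$-prolongation sequence starting with $S\otimes_{R_p}R_\pi$. On $S^*_p\otimes_{R_p}R_\pi$ put $\phi=\phi\otimes\phi$ and $\delta_\pi z=(\phi(z)-z^p)/\pi$; universality gives a canonical homomorphism $S^r_\pi\to S^r_p\otimes_{R_p}R_\pi$. For a tuple of variables ${\bf T}$, consider the polynomial rings $R_\pi[{\bf T},\delta_p{\bf T},\dots,\delta_p^i{\bf T}]$ with $\phi(\delta_p^i{\bf T})=(\delta_p^i{\bf T})^p+p\,\delta_p^{i+1}{\bf T}$ and $\delta_\pi f=(\phi(f)-f^p)/\pi$.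 Sending the variable $\delta_\pi^i{\bf T}$ to the polynomial $\{\delta_\pi^i{\bf T}\}_{|{\bf T}=0}$ in $\delta_p{\bf T},\dots,\delta_p^i{\bf T}$ gives, together with the canonical homomorphism on coefficients, the natural homomorphism $$(\ast)\qquad S^r_\pi[\delta_\pi{\bf T},\dots,\delta_\pi^r{\bf T}]\hat{\ }\longrightarrow (S^r_p\otimes_{R_p}R_\pi)[\delta_p{\bf T},\dots,\delta_p^r{\bf T}]\hat{\ }.$$ Let $\mathcal F\in S[[T_1,T_2]]$ be a one-dimensional formal group law over $S$ and let $l(T)=\sum_{n\ge1}a_nT^n\in(S\otimes\mathbb Q)[[T]]$ be its logarithm. With respect to the natural $\delta_p$-prolongation sequences $(S^r_p[[{\bf T},\delta_p{\bf T},\dots,\delta_p^r{\bf T}]])_{r\ge0}$, where ${\bf T}=(T_1,T_2)$, respectively ${\bf T}=T$, set $$F_r:=\{\delta_p^r\mathcal F\}_{|{\bf T}=0},\qquad L^r_p:=\tfrac1p\{\phi^r(l(T))\}_{|T=0}\in(S^r_p\otimes\mathbb Q)[[\delta_pT,\dots,\delta_p^rT]].$$ Then: 1) For some integer $n(r)\ge1$,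 $p^{n(r)}F_r$ belongs to the image of $(\ast)$ for ${\bf T}=(T_1,T_2)$. 2) If $v_p(\pi)\ge\frac1{p-1}$, then $L^r_\pi:=\frac p\pi L^r_p$ belongs to the image of $(\ast)$ for the single variable ${\bf T}=T$. -/

import Mathlib

noncomputable section

namespace PiJet

open scoped TensorProduct

universe u v

/-! ## Polynomial rings with a Fermat quotient operator -/

/-- A domain `R` with an element `ϖ ≠ 0` dividing `p` and an endomorphism `φ` fixing `ϖ` and
lifting the `p`-power Frobenius of `R / ϖ`. Two instances are built below: `(R_p, p)` and
`(R_π, π)`. -/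
structure FrobBase (p : ℕ) (R : Type*) [CommRing R] where
  ϖ : R
  ϖ_ne_zero : ϖ ≠ 0
  dvd_p : ϖ ∣ (p : R)
  φ : R →+* R
  φ_ϖ : φ ϖ = ϖ
  dvd_frob : ∀ x, ϖ ∣ φ x - x ^ p

section Polynomials

variable {p : ℕ} {R : Type*} [CommRing R] (B : FrobBase p R) {ι : Type*}

/-- In `MvPolynomial (ι × ℕ) R` the variable `(a, i)` plays the role of the `i`-th derivative
`δ^i x_a` of the variable `x_a = (a, 0)`. This is the `φ`-semilinear ring endomorphism with
`δ^i x_a ↦ (δ^i x_a)^p + c · δ^(i+1) x_a`. -/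
def Phi (c : R) : MvPolynomial (ι × ℕ) R →+* MvPolynomial (ι × ℕ) R :=
  MvPolynomial.eval₂Hom (MvPolynomial.C.comp B.φ)
    (fun s => MvPolynomial.X s ^ p + MvPolynomial.C c * MvPolynomial.X (s.1, s.2 + 1))

open Classical in
/-- The `ϖ`-derivation `f ↦ (Φ(f) - f^p) / ϖ` on `MvPolynomial (ι × ℕ) R` attached to `Phi B c`;
for `ϖ ∣ c` the division is always possible, and unique, see `delta_spec`. -/
def delta (c : R) (f : MvPolynomial (ι × ℕ) R) : MvPolynomial (ι × ℕ) R :=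
  if h : ∃ g, MvPolynomial.C B.ϖ * g = Phi B c f - f ^ p then h.choose else 0

theorem exists_delta [Fact p.Prime] {c : R} (hc : B.ϖ ∣ c) (f : MvPolynomial (ι × ℕ) R) :
    ∃ g, MvPolynomial.C B.ϖ * g = Phi B c f - f ^ p := by
  suffices h : MvPolynomial.C B.ϖ ∣ Phi B c f - f ^ p by
    obtain ⟨g, hg⟩ := h
    exact ⟨g, hg.symm⟩
  have hp0 : (MvPolynomial.C B.ϖ : MvPolynomial (ι × ℕ) R) ∣ (p : MvPolynomial (ι × ℕ) R) := by
    have := map_dvd (MvPolynomial.C (σ := ι × ℕ)) B.dvd_p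
    simpa using this
  induction f using MvPolynomial.induction_on with
  | C a =>
    have := map_dvd (MvPolynomial.C (σ := ι × ℕ)) (B.dvd_frob a)
    simpa [Phi] using this
  | add f g hf hg =>
    obtain ⟨r, hr⟩ := exists_add_pow_prime_eq (Fact.out : p.Prime) f g
    rw [hr, map_add]
    have : Phi B c f + Phi B c g - (f ^ p + g ^ p + p * f * g * r)
        = (Phi B c f - f ^ p) + (Phi B c g - g ^ p) - p * (f * g * r) := by ring
    rw [this]
    exact dvd_sub (dvd_add hf hg) (Dvd.dvd.mul_right hp0 _)
  | mul_X f s hf =>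
    have hX : Phi B c (MvPolynomial.X s)
        = MvPolynomial.X s ^ p + MvPolynomial.C c * MvPolynomial.X (s.1, s.2 + 1) := by
      simp [Phi]
    rw [map_mul, hX]
    have : Phi B c f * (MvPolynomial.X s ^ p + MvPolynomial.C c * MvPolynomial.X (s.1, s.2 + 1))
        - (f * MvPolynomial.X s) ^ p = (Phi B c f - f ^ p) * MvPolynomial.X s ^ p
          + MvPolynomial.C c * (Phi B c f * MvPolynomial.X (s.1, s.2 + 1)) := by
      rw [mul_pow]; ring
    rw [this]
    exact dvd_add (Dvd.dvd.mul_right hf _)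
      (Dvd.dvd.mul_right (map_dvd (MvPolynomial.C (σ := ι × ℕ)) hc) _)

theorem delta_spec [Fact p.Prime] {c : R} (hc : B.ϖ ∣ c) (f : MvPolynomial (ι × ℕ) R) :
    MvPolynomial.C B.ϖ * delta B c f = Phi B c f - f ^ p := by
  have h := exists_delta B hc f
  rw [delta, dif_pos h]
  exact h.choose_spec

theorem Phi_eq [Fact p.Prime] {c : R} (hc : B.ϖ ∣ c) (f : MvPolynomial (ι × ℕ) R) :
    Phi B c f = f ^ p + MvPolynomial.C B.ϖ * delta B c f := by
  rw [delta_spec B hc]; ring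

theorem C_mul_cancel [IsDomain R] {x y : MvPolynomial (ι × ℕ) R}
    (h : MvPolynomial.C B.ϖ * x = MvPolynomial.C B.ϖ * y) : x = y :=
  mul_left_cancel₀ (by simpa using B.ϖ_ne_zero) h

theorem delta_add [Fact p.Prime] [IsDomain R] {c : R} (hc : B.ϖ ∣ c)
    (f g : MvPolynomial (ι × ℕ) R) :
    ∃ r, delta B c (f + g) = delta B c f + delta B c g + f * r := by
  obtain ⟨r, hr⟩ := exists_add_pow_prime_eq (Fact.out : p.Prime) f g
  obtain ⟨q, hq⟩ := B.dvd_p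
  refine ⟨- (MvPolynomial.C q * g * r), C_mul_cancel B ?_⟩
  have hq' : (p : MvPolynomial (ι × ℕ) R) = MvPolynomial.C B.ϖ * MvPolynomial.C q := by
    rw [← map_mul, ← hq, map_natCast]
  rw [mul_add, mul_add, delta_spec B hc, delta_spec B hc, delta_spec B hc, hr, map_add, hq']
  ring

theorem delta_mul [Fact p.Prime] [IsDomain R] {c : R} (hc : B.ϖ ∣ c)
    (f g : MvPolynomial (ι × ℕ) R) :
    delta B c (f * g) = Phi B c f * delta B c g + delta B c f * g ^ p := by
  refine C_mul_cancel B ?_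
  have h1 := delta_spec B hc f
  have h2 := delta_spec B hc g
  rw [delta_spec B hc, map_mul, mul_add, mul_left_comm, h2, ← mul_assoc, h1]
  ring

/-- `delta` maps the ideal generated by `G` into any ideal that contains `G` and `delta G`. -/
theorem delta_mem [Fact p.Prime] [IsDomain R] {c : R} (hc : B.ϖ ∣ c)
    {G : Set (MvPolynomial (ι × ℕ) R)} {K : Ideal (MvPolynomial (ι × ℕ) R)}
    (hG : ∀ g ∈ G, g ∈ K) (hG' : ∀ g ∈ G, delta B c g ∈ K)
    {x : MvPolynomial (ι × ℕ) R} (hx : x ∈ Ideal.span G) : delta B c x ∈ K := by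
  have hp := (Fact.out : p.Prime).ne_zero
  have hsp : Ideal.span G ≤ K := Ideal.span_le.2 hG
  induction hx using Submodule.span_induction with
  | mem x h => exact hG' x h
  | zero =>
    have : delta B c (0 : MvPolynomial (ι × ℕ) R) = 0 :=
      C_mul_cancel B (by rw [delta_spec B hc]; simp [hp])
    rw [this]; exact K.zero_mem
  | add x y hx _ ihx ihy =>
    obtain ⟨r, hr⟩ := delta_add B hc x y
    rw [hr]
    exact K.add_mem (K.add_mem ihx ihy) (K.mul_mem_right _ (hsp hx))
  | smul a x hx ih =>
    rw [smul_eq_mul, delta_mul B hc]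
    exact K.add_mem (K.mul_mem_left _ ih)
      (K.mul_mem_left _ (K.pow_mem_of_mem (hsp hx) p (Nat.pos_of_ne_zero hp)))

/-- A ring endomorphism that intertwines `Phi` and fixes `ϖ` intertwines `delta`. -/
theorem delta_comm [Fact p.Prime] {R' : Type*} [CommRing R'] [IsDomain R'] {ι' : Type*}
    (B' : FrobBase p R') {c : R} {c' : R'} (hc : B.ϖ ∣ c) (hc' : B'.ϖ ∣ c')
    (θ : MvPolynomial (ι × ℕ) R →+* MvPolynomial (ι' × ℕ) R')
    (hθϖ : θ (MvPolynomial.C B.ϖ) = MvPolynomial.C B'.ϖ)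
    (hθ : ∀ f, θ (Phi B c f) = Phi B' c' (θ f)) (f : MvPolynomial (ι × ℕ) R) :
    θ (delta B c f) = delta B' c' (θ f) := by
  refine C_mul_cancel B' ?_
  rw [delta_spec B' hc', ← hθϖ, ← map_mul, delta_spec B hc, map_sub, map_pow, hθ]

theorem delta_X [Fact p.Prime] [IsDomain R] {c q : R} (hc : c = B.ϖ * q) (s : ι × ℕ) :
    delta B c (MvPolynomial.X s) = MvPolynomial.C q * MvPolynomial.X (s.1, s.2 + 1) := by
  refine C_mul_cancel B ?_
  rw [delta_spec B ⟨q, hc⟩, ← mul_assoc, ← map_mul, ← hc]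
  simp [Phi]

/-- `δ^i x_a` has no constant term. -/
theorem constantCoeff_delta_iterate [Fact p.Prime] [IsDomain R] {c : R} (hc : B.ϖ ∣ c)
    (s : ι × ℕ) (i : ℕ) :
    MvPolynomial.constantCoeff ((delta B c)^[i] (MvPolynomial.X s)) = 0 := by
  obtain ⟨q, hq⟩ := hc
  set K : Ideal (MvPolynomial (ι × ℕ) R) := Ideal.span (Set.range MvPolynomial.X) with hK
  have key : (delta B c)^[i] (MvPolynomial.X s) ∈ K := by
    induction i with
    | zero => exact Ideal.subset_span ⟨s, rfl⟩
    | succ i ih =>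
      rw [Function.iterate_succ_apply']
      refine delta_mem B ⟨q, hq⟩ (fun g hg => Ideal.subset_span hg) ?_ ih
      rintro _ ⟨t, rfl⟩
      rw [delta_X B hq]
      exact K.mul_mem_left _ (Ideal.subset_span ⟨_, rfl⟩)
  have hle : K ≤ RingHom.ker (MvPolynomial.constantCoeff (σ := ι × ℕ) (R := R)) := by
    rw [hK, Ideal.span_le]
    rintro _ ⟨t, rfl⟩
    simp [RingHom.mem_ker]
  exact hle key

/-- The ideal of multiples of the derivatives of order `≤ i` of `h`. -/
def derivIdeal (c : R) (h : MvPolynomial (ι × ℕ) R) (i : ℕ) : Ideal (MvPolynomial (ι × ℕ) R) :=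
  Ideal.span {g | ∃ j ≤ i, g = (delta B c)^[j] h}

theorem Phi_iterate_mem [Fact p.Prime] [IsDomain R] {c : R} (hc : B.ϖ ∣ c)
    (h : MvPolynomial (ι × ℕ) R) (i : ℕ) : (Phi B c)^[i] h ∈ derivIdeal B c h i := by
  induction i with
  | zero => exact Ideal.subset_span ⟨0, le_rfl, rfl⟩
  | succ i ih =>
    rw [Function.iterate_succ_apply', Phi_eq B hc]
    have hmono : derivIdeal B c h i ≤ derivIdeal B c h (i + 1) :=
      Ideal.span_mono fun g ⟨j, hj, hg⟩ => ⟨j, by omega, hg⟩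
    refine Ideal.add_mem _ (Ideal.pow_mem_of_mem _ (hmono ih) p (Fact.out : p.Prime).pos)
      (Ideal.mul_mem_left _ _ (delta_mem B hc (fun g hg => hmono (Ideal.subset_span hg)) ?_ ih))
    rintro _ ⟨j, hj, rfl⟩
    exact Ideal.subset_span ⟨j + 1, by omega, (Function.iterate_succ_apply' _ _ _).symm⟩

/-- `delta` raises the order by at most one. -/
theorem delta_supported [Fact p.Prime] [IsDomain R] {c : R} (hc : B.ϖ ∣ c) (n : ℕ)
    {f : MvPolynomial (ι × ℕ) R} (hf : f ∈ MvPolynomial.supported R {s : ι × ℕ | s.2 ≤ n}) :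
    delta B c f ∈ MvPolynomial.supported R {s : ι × ℕ | s.2 ≤ n + 1} := by
  classical
  set V := MvPolynomial.supported R {s : ι × ℕ | s.2 ≤ n + 1} with hV
  have hmono : MvPolynomial.supported R {s : ι × ℕ | s.2 ≤ n} ≤ V :=
    MvPolynomial.supported_mono fun s (hs : s.2 ≤ n) => (by simp; omega)
  have hPhi : Phi B c f ∈ V := by
    rw [MvPolynomial.supported] at hf
    induction hf using Algebra.adjoin_induction with
    | mem x hx =>
      obtain ⟨s, hs, rfl⟩ := hx
      simp only [Set.mem_ofPred_eq] at hs
      have h1 : (MvPolynomial.X s : MvPolynomial (ι × ℕ) R) ∈ V :=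
        Algebra.subset_adjoin ⟨s, by simp; omega, rfl⟩
      have h2 : (MvPolynomial.X (s.1, s.2 + 1) : MvPolynomial (ι × ℕ) R) ∈ V :=
        Algebra.subset_adjoin ⟨_, by simp; omega, rfl⟩
      simp only [Phi, MvPolynomial.eval₂Hom_X']
      exact V.add_mem (V.pow_mem h1 p) (V.mul_mem (V.algebraMap_mem c) h2)
    | algebraMap r =>
      simp only [Phi, MvPolynomial.algebraMap_eq, MvPolynomial.eval₂Hom_C, RingHom.comp_apply]
      exact V.algebraMap_mem _
    | add x y _ _ hx hy => rw [map_add]; exact V.add_mem hx hy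
    | mul x y _ _ hx hy => rw [map_mul]; exact V.mul_mem hx hy
  let k : MvPolynomial (ι × ℕ) R →ₐ[R] MvPolynomial (ι × ℕ) R :=
    MvPolynomial.aeval fun s => if s.2 ≤ n + 1 then MvPolynomial.X s else 0
  have hkV : ∀ x ∈ V, k x = x := by
    intro x hx
    rw [hV, MvPolynomial.supported] at hx
    induction hx using Algebra.adjoin_induction with
    | mem x hx =>
      obtain ⟨s, hs, rfl⟩ := hx
      simp only [Set.mem_ofPred_eq] at hs
      simp [k, hs]
    | algebraMap r => exact k.commutes r
    | add x y _ _ hx hy => rw [map_add, hx, hy]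
    | mul x y _ _ hx hy => rw [map_mul, hx, hy]
  have hkr : ∀ x, k x ∈ V := by
    intro x
    induction x using MvPolynomial.induction_on with
    | C a => rw [← MvPolynomial.algebraMap_eq, k.commutes]; exact V.algebraMap_mem a
    | add f g hf hg => rw [map_add]; exact V.add_mem hf hg
    | mul_X f s hf =>
      rw [map_mul]
      refine V.mul_mem hf ?_
      simp only [k, MvPolynomial.aeval_X]
      split_ifs with h
      · exact Algebra.subset_adjoin ⟨s, h, rfl⟩
      · exact V.zero_mem
  have : k (delta B c f) = delta B c f := by
    refine C_mul_cancel B ?_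
    have h1 : k (MvPolynomial.C B.ϖ * delta B c f) = MvPolynomial.C B.ϖ * k (delta B c f) := by
      rw [map_mul, ← MvPolynomial.algebraMap_eq, k.commutes]
    rw [← h1, delta_spec B hc]
    exact hkV _ (V.sub_mem hPhi (V.pow_mem (hmono hf) p))
  rw [← this]
  exact hkr _

theorem delta_iterate_supported [Fact p.Prime] [IsDomain R] {c : R} (hc : B.ϖ ∣ c)
    {f : MvPolynomial (ι × ℕ) R} (hf : f ∈ MvPolynomial.supported R {s : ι × ℕ | s.2 ≤ 0})
    (i : ℕ) : (delta B c)^[i] f ∈ MvPolynomial.supported R {s : ι × ℕ | s.2 ≤ i} := by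
  induction i with
  | zero => exact hf
  | succ i ih => rw [Function.iterate_succ_apply']; exact delta_supported B hc i ih

/-- The inclusion `R[x_a] ⊂ R[x_a, δ x_a, δ² x_a, …]`. -/
def emb : MvPolynomial ι R →ₐ[R] MvPolynomial (ι × ℕ) R :=
  MvPolynomial.rename fun a => (a, 0)

theorem emb_supported (f : MvPolynomial ι R) :
    emb f ∈ MvPolynomial.supported R {s : ι × ℕ | s.2 ≤ 0} := by
  rw [emb, MvPolynomial.supported_eq_range_rename]
  refine ⟨MvPolynomial.rename (fun a => ⟨(a, 0), by simp⟩) f, ?_⟩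
  rw [AlgHom.toRingHom_eq_coe, RingHom.coe_coe, MvPolynomial.rename_rename]
  rfl

/-- The retraction `R[x_a, δ x_a, …] → R[x_a, …, δ^n x_a]`; it is only used on polynomials of
order `≤ n`, which it merely reinterprets. -/
def truncOrder (n : ℕ) :
    MvPolynomial (ι × ℕ) R →ₐ[R] MvPolynomial (ι × Fin (n + 1)) R :=
  MvPolynomial.aeval fun s => if h : s.2 < n + 1 then MvPolynomial.X (s.1, ⟨s.2, h⟩) else 0

/-- For a set `G` of polynomials in variables `x_a`, the ideal
`(δ^i g : g ∈ G, i ≤ n)` of `R[x_a, …, δ^n x_a]`. -/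
def jetIdeal (G : Set (MvPolynomial ι R)) (n : ℕ) : Ideal (MvPolynomial (ι × Fin (n + 1)) R) :=
  Ideal.span {h | ∃ g ∈ G, ∃ i ≤ n, h = truncOrder n ((delta B B.ϖ)^[i] (emb g))}

/-- The `n`-th ring `R[x, δx, …, δ^n x] / (g, δg, …, δ^n g : g ∈ G)` of the universal
prolongation sequence of the `R`-algebra `R[x] / (G)` (before completion). -/
abbrev JetRing (G : Set (MvPolynomial ι R)) (n : ℕ) : Type _ :=
  MvPolynomial (ι × Fin (n + 1)) R ⧸ jetIdeal B G n

/-- The projection `R[x, δx, …] → JetRing B G n`, for polynomials of order `≤ n`. -/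
def toJet (G : Set (MvPolynomial ι R)) (n : ℕ) : MvPolynomial (ι × ℕ) R →ₐ[R] JetRing B G n :=
  (Ideal.Quotient.mkₐ R (jetIdeal B G n)).comp (truncOrder n)

theorem toJet_delta {G : Set (MvPolynomial ι R)} {g : MvPolynomial ι R} (hg : g ∈ G)
    {i n : ℕ} (hi : i ≤ n) : toJet B G n ((delta B B.ϖ)^[i] (emb g)) = 0 :=
  Ideal.Quotient.eq_zero_iff_mem.2 (Ideal.subset_span ⟨g, hg, i, hi, rfl⟩)

end Polynomials

/-! ## The rings `R_p` and `R_π` -/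

section Base

variable (p : ℕ) [Fact p.Prime]

/-- `R_p`, the completion of the maximal unramified extension of `ℤ_p`, i.e. the ring of Witt
vectors of an algebraic closure of `𝔽_p`. -/
abbrev Rp : Type := WittVector p (AlgebraicClosure (ZMod p))

/-- The inclusion `ℤ_p = W(𝔽_p) → R_p`. -/
def fromZp : ℤ_[p] →+* Rp p :=
  (WittVector.map (algebraMap (ZMod p) (AlgebraicClosure (ZMod p)))).comp
    (WittVector.equiv p).symm.toRingHom

/-- `R_p` with uniformizer `p` and the Frobenius lift `φ`. -/
def baseP : FrobBase p (Rp p) where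
  ϖ := p
  ϖ_ne_zero := WittVector.p_nonzero p _
  dvd_p := dvd_rfl
  φ := WittVector.frobenius
  φ_ϖ := map_natCast _ _
  dvd_frob x := by
    rw [← Ideal.mem_span_singleton, WittVector.mem_span_p_iff_coeff_zero_eq_zero,
      ← WittVector.constantCoeff_apply, map_sub, map_pow, WittVector.constantCoeff_apply,
      WittVector.constantCoeff_apply, WittVector.coeff_frobenius_charP, sub_self]

/-- An Eisenstein polynomial of degree `e ≥ 2` over `ℤ_p`. -/
structure EisensteinPoly where
  poly : Polynomial ℤ_[p]
  monic : poly.Monic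
  eisenstein : poly.IsEisensteinAt (Ideal.span {(p : ℤ_[p])})
  two_le : 2 ≤ poly.natDegree

variable {p} (P : EisensteinPoly p)

/-- The Eisenstein polynomial, viewed over `R_p`. -/
def EisensteinPoly.polyR : Polynomial (Rp p) := P.poly.map (fromZp p)

theorem EisensteinPoly.polyR_monic : P.polyR.Monic := P.monic.map _

theorem fromZp_dvd {x : ℤ_[p]} (h : (p : Rp p) ∣ fromZp p x) : (p : ℤ_[p]) ∣ x := by
  rw [← Ideal.mem_span_singleton, WittVector.mem_span_p_iff_coeff_zero_eq_zero] at h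
  have h0 : ((WittVector.equiv p).symm x).coeff 0 = 0 := by
    simpa [fromZp, WittVector.map_coeff] using h
  have h1 : (WittVector.equiv p).symm x ∈ Ideal.span {(p : WittVector p (ZMod p))} :=
    (WittVector.mem_span_p_iff_coeff_zero_eq_zero _).2 h0
  obtain ⟨y, hy⟩ := Ideal.mem_span_singleton.1 h1
  refine ⟨WittVector.equiv p y, ?_⟩
  have := congrArg (WittVector.equiv p) hy
  simpa using this

theorem frobenius_fromZp (x : ℤ_[p]) : WittVector.frobenius (fromZp p x) = fromZp p x := by
  ext n
  have h := congrArg (fun w => w.coeff n)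
    (WittVector.frobenius_zmodp (p := p) ((WittVector.equiv p).symm x))
  simp only [WittVector.coeff_frobenius_charP] at h
  simp only [WittVector.coeff_frobenius_charP, fromZp, RingHom.comp_apply, WittVector.map_coeff]
  rw [← map_pow]
  exact congrArg _ h

theorem EisensteinPoly.polyR_irreducible : Irreducible P.polyR := by
  have hprime : (Ideal.span {(p : Rp p)}).IsPrime := by
    rw [Ideal.span_singleton_prime (WittVector.p_nonzero p _)]
    exact (WittVector.irreducible p).prime
  have hdeg : P.polyR.natDegree = P.poly.natDegree := P.monic.natDegree_map _
  refine Polynomial.IsEisensteinAt.irreducible (𝓟 := Ideal.span {(p : Rp p)}) ?_ hprime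
    P.polyR_monic.isPrimitive (by have := P.two_le; omega)
  refine P.polyR_monic.isEisensteinAt_of_mem_of_notMem hprime.ne_top ?_ ?_
  · intro n hn
    have := P.eisenstein.mem (hdeg ▸ hn)
    obtain ⟨y, hy⟩ := Ideal.mem_span_singleton.1 this
    rw [EisensteinPoly.polyR, Polynomial.coeff_map, hy, map_mul, map_natCast]
    exact Ideal.mul_mem_right _ _ (Ideal.mem_span_singleton_self _)
  · intro h
    have h0 : P.poly.coeff 0 ∈ Ideal.span {(p : ℤ_[p])} :=
      P.eisenstein.mem (by have := P.two_le; omega)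
    obtain ⟨y, hy⟩ := Ideal.mem_span_singleton.1 h0
    rw [Ideal.span_singleton_pow, Ideal.mem_span_singleton, EisensteinPoly.polyR,
      Polynomial.coeff_map, hy, map_mul, map_natCast, pow_two] at h
    have h2 := fromZp_dvd ((mul_dvd_mul_iff_left (WittVector.p_nonzero p _)).1 h)
    apply P.eisenstein.notMem
    rw [hy, Ideal.span_singleton_pow, Ideal.mem_span_singleton, pow_two]
    exact mul_dvd_mul_left _ h2

/-- `R_π = R_p[π] = R_p[x] / (P)`. -/
abbrev Rpi : Type := AdjoinRoot P.polyR

/-- The root `π` of the Eisenstein polynomial in `R_π`. -/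
def piR : Rpi P := AdjoinRoot.root P.polyR

instance : IsDomain (Rpi P) :=
  AdjoinRoot.isDomain_of_prime P.polyR_irreducible.prime

/-- The extension of `φ` to `R_π` with `φ(π) = π`. -/
def phiPi : Rpi P →+* Rpi P :=
  AdjoinRoot.lift ((AdjoinRoot.of P.polyR).comp WittVector.frobenius) (AdjoinRoot.root P.polyR) (by
    have h : P.polyR.map (WittVector.frobenius (p := p)) = P.polyR := by
      rw [EisensteinPoly.polyR, Polynomial.map_map]
      congr 1
      exact RingHom.ext frobenius_fromZp
    rw [← Polynomial.eval₂_map, h, AdjoinRoot.eval₂_root])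

theorem piR_dvd_p : piR P ∣ (p : Rpi P) := by
  have h0 : P.poly.coeff 0 ∈ Ideal.span {(p : ℤ_[p])} :=
    P.eisenstein.mem (by have := P.two_le; omega)
  obtain ⟨y, hy⟩ := Ideal.mem_span_singleton.1 h0
  have hyu : IsUnit y := by
    by_contra hcon
    have hmem : y ∈ IsLocalRing.maximalIdeal ℤ_[p] := hcon
    rw [PadicInt.maximalIdeal_eq_span_p, Ideal.mem_span_singleton] at hmem
    apply P.eisenstein.notMem
    rw [hy, Ideal.span_singleton_pow, Ideal.mem_span_singleton, pow_two]
    exact mul_dvd_mul_left _ hmem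
  have hroot : Polynomial.eval₂ (AdjoinRoot.of P.polyR) (piR P) P.polyR = 0 :=
    AdjoinRoot.eval₂_root _
  have hsplit := Polynomial.X_mul_divX_add P.polyR
  have hroot' := (congrArg (Polynomial.eval₂ (AdjoinRoot.of P.polyR) (piR P)) hsplit).trans hroot
  rw [Polynomial.eval₂_add, Polynomial.eval₂_mul, Polynomial.eval₂_X,
    Polynomial.eval₂_C] at hroot'
  have hdvd : piR P ∣ AdjoinRoot.of P.polyR (P.polyR.coeff 0) :=
    (dvd_add_right (Dvd.intro _ rfl)).1 (hroot' ▸ dvd_zero _)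
  have hcoeff : P.polyR.coeff 0 = p * fromZp p y := by
    rw [EisensteinPoly.polyR, Polynomial.coeff_map, hy, map_mul, map_natCast]
  rw [hcoeff, map_mul, map_natCast] at hdvd
  exact ((hyu.map (fromZp p)).map (AdjoinRoot.of P.polyR)).dvd_mul_right.1 hdvd

theorem piR_ne_zero : piR P ≠ 0 := by
  intro h
  have h1 : (p : Rpi P) = 0 := by simpa [h] using piR_dvd_p P
  have hinj := AdjoinRoot.of.injective_of_degree_ne_zero (f := P.polyR) (by
    intro hd
    have h2 := Polynomial.natDegree_eq_zero_iff_degree_le_zero.2 hd.le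
    have h3 : P.polyR.natDegree = P.poly.natDegree := P.monic.natDegree_map _
    have := P.two_le
    omega)
  exact WittVector.p_nonzero p (AlgebraicClosure (ZMod p)) (hinj (by simpa using h1))

/-- `R_π` with uniformizer `π` and the Frobenius lift `φ`. -/
def basePi : FrobBase p (Rpi P) where
  ϖ := piR P
  ϖ_ne_zero := piR_ne_zero P
  dvd_p := piR_dvd_p P
  φ := phiPi P
  φ_ϖ := by simp [phiPi, piR]
  dvd_frob x := by
    have hp := (Fact.out : p.Prime)
    induction x using AdjoinRoot.induction_on with
    | ih f =>
      induction f using Polynomial.induction_on' with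
      | add f g hf hg =>
        obtain ⟨r, hr⟩ := exists_add_pow_prime_eq hp (AdjoinRoot.mk P.polyR f)
          (AdjoinRoot.mk P.polyR g)
        rw [map_add, hr, map_add, show ∀ a b c d e : Rpi P,
          a + b - (c + d + e) = (a - c) + (b - d) - e by intros; ring]
        refine dvd_sub (dvd_add hf hg) ?_
        rw [mul_assoc, mul_assoc]
        exact Dvd.dvd.mul_right (piR_dvd_p P) _
      | monomial n a =>
        rw [← Polynomial.C_mul_X_pow_eq_monomial, map_mul, map_pow, AdjoinRoot.mk_C,
          AdjoinRoot.mk_X, map_mul, map_pow]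
        have h1 : phiPi P (AdjoinRoot.root P.polyR) = piR P := by simp [phiPi, piR]
        have h2 : phiPi P (AdjoinRoot.of P.polyR a)
            = AdjoinRoot.of P.polyR (WittVector.frobenius a) := by simp [phiPi]
        rw [h1, h2]
        rcases Nat.eq_zero_or_pos n with rfl | hn
        · simp only [pow_zero, mul_one]
          rw [← map_pow, ← map_sub]
          refine (piR_dvd_p P).trans ?_
          have := map_dvd (AdjoinRoot.of P.polyR) ((baseP p).dvd_frob a)
          simpa [baseP] using this
        · refine dvd_sub (Dvd.dvd.mul_left (dvd_pow_self _ hn.ne') _) ?_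
          refine dvd_pow (Dvd.dvd.mul_left ?_ _) hp.ne_zero
          exact dvd_pow_self _ hn.ne'

/-- The element `p / π` of `R_π`. -/
def pDivPi : Rpi P := (piR_dvd_p P).choose

theorem piR_mul_pDivPi : piR P * pDivPi P = p := (piR_dvd_p P).choose_spec.symm

/-- The valuation on `R_π`, with uniformizer `π`, normalized by `v_p(p) = 1` (for `x ≠ 0`). -/
def vp (x : Rpi P) : ℚ := (multiplicity (piR P) x : ℚ) / (multiplicity (piR P) (p : Rpi P) : ℚ)

end Base

/-! ## Jet rings of a smooth algebra and the comparison map -/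

section Jets

variable (p : ℕ) [Fact p.Prime] (S : Type u) [CommRing S] [Algebra (Rp p) S]

/-- The relations of the tautological presentation `R_p[x_a : a ∈ S] → S`, `x_a ↦ a`. -/
def relP : Set (MvPolynomial S (Rp p)) :=
  {f | MvPolynomial.aeval (id : S → S) f = 0}

/-- The `r`-th ring of the universal `δ_p`-prolongation sequence of `S`. -/
abbrev JetP (r : ℕ) : Type u := JetRing (baseP p) (relP p S) r

/-- `S^r_p = 𝒪(J^r_p(Spec S))`, the `p`-adic completion of `JetP`. -/
abbrev Sp (r : ℕ) : Type u := AdicCompletion (Ideal.span {(p : JetP p S r)}) (JetP p S r)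

/-- The ring homomorphism `φ^r` from `S` to the `r`-th ring of its universal `δ_p`-prolongation
sequence. -/
def phiJet (r : ℕ) : S →+* JetP p S r :=
  (MvPolynomial.aeval (R := Rp p) (id : S → S)).toRingHom.liftOfRightInverse MvPolynomial.X
    (fun a => by simp)
    ⟨((toJet (baseP p) (relP p S) r).toRingHom.comp
        ((Phi (baseP p) (baseP p).ϖ) ^ r)).comp emb.toRingHom, by
      intro f hf
      have hf' : f ∈ relP p S := hf
      have h := Phi_iterate_mem (baseP p) dvd_rfl (emb f) r
      have hle : derivIdeal (baseP p) (baseP p).ϖ (emb f) r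
          ≤ RingHom.ker (toJet (baseP p) (relP p S) r).toRingHom := by
        rw [derivIdeal, Ideal.span_le]
        rintro _ ⟨j, hj, rfl⟩
        exact toJet_delta (baseP p) hf' hj
      have := hle h
      rw [RingHom.mem_ker] at this ⊢
      simpa [RingHom.coe_pow] using this⟩

variable {p} (P : EisensteinPoly p)

/-- The relations of the presentation `R_π[x_a : a ∈ S] → R_π ⊗ S` obtained from `relP` by base
change. -/
def relPi : Set (MvPolynomial S (Rpi P)) :=
  MvPolynomial.map (algebraMap (Rp p) (Rpi P)) '' relP p S

/-- The `r`-th ring of the universal `δ_π`-prolongation sequence of `R_π ⊗ S`. -/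
abbrev JetPi (r : ℕ) : Type u := JetRing (basePi P) (relPi S P) r

/-- `S^r_π = 𝒪(J^r_π(Spec (R_π ⊗ S)))`, the `p`-adic completion of `JetPi`. -/
abbrev Spi (r : ℕ) : Type u := AdicCompletion (Ideal.span {(p : JetPi S P r)}) (JetPi S P r)

/-- `R_π ⊗_{R_p} S^r_p`. -/
abbrev SpTensor (r : ℕ) : Type u := Rpi P ⊗[Rp p] Sp p S r

/-- The polynomial `δ_π^i x_a`, with coefficients in `R_π`, in `x_a, δ_p x_a, …, δ_p^i x_a`:
here `φ(δ_p^i x_a) = (δ_p^i x_a)^p + p δ_p^(i+1) x_a` and `δ_π f = (φ(f) - f^p) / π`. -/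
def deltaPiVar {ι : Type*} (a : ι) (i : ℕ) : MvPolynomial (ι × ℕ) (Rpi P) :=
  (delta (basePi P) (p : Rpi P))^[i] (MvPolynomial.X (a, 0))

/-- The evaluation `δ_p^i x_a ↦ 1 ⊗ δ_p^i a`, for polynomials of order `≤ r`. -/
def evalTensor (r : ℕ) :
    MvPolynomial (S × ℕ) (Rpi P) →ₐ[Rpi P] Rpi P ⊗[Rp p] JetP p S r :=
  MvPolynomial.aeval fun s => (1 : Rpi P) ⊗ₜ[Rp p] toJet (baseP p) (relP p S) r (MvPolynomial.X s)

theorem evalTensor_map (r : ℕ) (f : MvPolynomial (S × ℕ) (Rp p)) :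
    evalTensor S P r (MvPolynomial.map (algebraMap (Rp p) (Rpi P)) f)
      = (1 : Rpi P) ⊗ₜ[Rp p] toJet (baseP p) (relP p S) r f := by
  rw [evalTensor, MvPolynomial.aeval_map_algebraMap]
  have : (MvPolynomial.aeval (R := Rp p) fun s =>
        (1 : Rpi P) ⊗ₜ[Rp p] toJet (baseP p) (relP p S) r (MvPolynomial.X s))
      = (Algebra.TensorProduct.includeRight (A := Rpi P)).comp (toJet (baseP p) (relP p S) r) := by
    apply MvPolynomial.algHom_ext
    intro s
    simp
  rw [this]
  rfl

/-- The substitution `δ_π^i x_a ↦ deltaPiVar a i`. -/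
def subPi {ι : Type*} : MvPolynomial (ι × ℕ) (Rpi P) →ₐ[Rpi P] MvPolynomial (ι × ℕ) (Rpi P) :=
  MvPolynomial.aeval fun s => deltaPiVar P s.1 s.2

theorem subPi_Phi {ι : Type*} (f : MvPolynomial (ι × ℕ) (Rpi P)) :
    subPi P (Phi (basePi P) (basePi P).ϖ f) = Phi (basePi P) (p : Rpi P) (subPi P f) := by
  have : (subPi P).toRingHom.comp (Phi (basePi P) (basePi P).ϖ (ι := ι))
      = (Phi (basePi P) (p : Rpi P)).comp (subPi P).toRingHom := by
    apply MvPolynomial.ringHom_ext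
    · intro r
      simp [Phi, subPi]
    · intro s
      have h := Phi_eq (basePi P) (basePi P).dvd_p (deltaPiVar P s.1 s.2)
      have h2 : deltaPiVar P s.1 (s.2 + 1)
          = delta (basePi P) (p : Rpi P) (deltaPiVar P s.1 s.2) :=
        Function.iterate_succ_apply' _ _ _
      rw [← h2] at h
      simp only [AlgHom.toRingHom_eq_coe, RingHom.comp_apply, RingHom.coe_coe]
      have h3 : subPi P (MvPolynomial.X s) = deltaPiVar P s.1 s.2 := by simp [subPi]
      rw [h3, h]
      simp [Phi, subPi]
  exact congrArg (fun g => g f) this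

theorem subPi_delta {ι : Type*} (f : MvPolynomial (ι × ℕ) (Rpi P)) (i : ℕ) :
    subPi P ((delta (basePi P) (basePi P).ϖ)^[i] f)
      = (delta (basePi P) (p : Rpi P))^[i] (subPi P f) := by
  induction i with
  | zero => rfl
  | succ i ih =>
    rw [Function.iterate_succ_apply', Function.iterate_succ_apply', ← ih]
    exact delta_comm (basePi P) (basePi P) dvd_rfl (basePi P).dvd_p (subPi P).toRingHom
      (by simp [subPi]) (subPi_Phi P) _

theorem delta_map {ι : Type*} (f : MvPolynomial (ι × ℕ) (Rp p)) :
    delta (basePi P) (p : Rpi P) (MvPolynomial.map (algebraMap (Rp p) (Rpi P)) f)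
      = MvPolynomial.C (pDivPi P) *
        MvPolynomial.map (algebraMap (Rp p) (Rpi P)) (delta (baseP p) (baseP p).ϖ f) := by
  have hPhi : Phi (basePi P) (p : Rpi P) (MvPolynomial.map (algebraMap (Rp p) (Rpi P)) f)
      = MvPolynomial.map (algebraMap (Rp p) (Rpi P)) (Phi (baseP p) (baseP p).ϖ f) := by
    have : (Phi (basePi P) (p : Rpi P)).comp
          (MvPolynomial.map (σ := ι × ℕ) (algebraMap (Rp p) (Rpi P)))
        = (MvPolynomial.map (algebraMap (Rp p) (Rpi P))).comp (Phi (baseP p) (baseP p).ϖ) := by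
      apply MvPolynomial.ringHom_ext
      · intro r
        simp [Phi, basePi, baseP, phiPi, AdjoinRoot.algebraMap_eq]
      · intro s
        simp [Phi, baseP]
    exact congrArg (fun g => g f) this
  refine C_mul_cancel (basePi P) ?_
  rw [delta_spec _ (basePi P).dvd_p, hPhi, Phi_eq _ dvd_rfl, map_add, map_pow, add_sub_cancel_left,
    map_mul, ← mul_assoc, ← map_mul MvPolynomial.C]
  have : (basePi P).ϖ * pDivPi P = p := piR_mul_pDivPi P
  rw [this]
  simp [baseP]

theorem subPi_emb {ι : Type*} (f : MvPolynomial ι (Rp p)) :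
    subPi P (emb (MvPolynomial.map (algebraMap (Rp p) (Rpi P)) f))
      = MvPolynomial.map (algebraMap (Rp p) (Rpi P)) (emb f) := by
  have h : (subPi P).comp (emb (ι := ι)) = emb := by
    apply MvPolynomial.algHom_ext
    intro a
    simp [subPi, emb, deltaPiVar]
  rw [← AlgHom.comp_apply, h, emb, emb, MvPolynomial.map_rename]

/-- The relations defining `JetPi` hold in `R_π ⊗ JetP`. -/
theorem evalTensor_rel (r : ℕ) {f : MvPolynomial S (Rp p)} (hf : f ∈ relP p S) {i : ℕ}
    (hi : i ≤ r) : evalTensor S P r ((delta (basePi P) (p : Rpi P))^[i]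
      (MvPolynomial.map (algebraMap (Rp p) (Rpi P)) (emb f))) = 0 := by
  let K : ℕ → Ideal (MvPolynomial (S × ℕ) (Rpi P)) := fun i => Ideal.span
    {g | ∃ j ≤ i, g = MvPolynomial.map (algebraMap (Rp p) (Rpi P))
      ((delta (baseP p) (baseP p).ϖ)^[j] (emb f))}
  have hK : (delta (basePi P) (p : Rpi P))^[i]
      (MvPolynomial.map (algebraMap (Rp p) (Rpi P)) (emb f)) ∈ K i := by
    clear hi
    induction i with
    | zero => exact Ideal.subset_span ⟨0, le_rfl, rfl⟩
    | succ i ih =>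
      rw [Function.iterate_succ_apply']
      refine delta_mem (basePi P) (basePi P).dvd_p ?_ ?_ ih
      · rintro _ ⟨j, hj, rfl⟩
        exact Ideal.subset_span ⟨j, by omega, rfl⟩
      · rintro _ ⟨j, hj, rfl⟩
        rw [delta_map, ← Function.iterate_succ_apply' (delta (baseP p) (baseP p).ϖ)]
        exact Ideal.mul_mem_left _ _ (Ideal.subset_span ⟨j + 1, by omega, rfl⟩)
  have hle : K i ≤ RingHom.ker (evalTensor S P r).toRingHom := by
    rw [Ideal.span_le]
    rintro _ ⟨j, hj, rfl⟩
    rw [SetLike.mem_coe, RingHom.mem_ker]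
    change evalTensor S P r _ = 0
    rw [evalTensor_map, toJet_delta (baseP p) hf (hj.trans hi), TensorProduct.tmul_zero]
  exact hle hK

/-- The map `δ_π^i x_a ↦ δ_π^i (1 ⊗ a)` on polynomials of order `≤ r`. -/
def comparisonPre (r : ℕ) :
    MvPolynomial (S × Fin (r + 1)) (Rpi P) →ₐ[Rpi P] Rpi P ⊗[Rp p] JetP p S r :=
  MvPolynomial.aeval fun s => evalTensor S P r (deltaPiVar P s.1 s.2)

theorem comparisonPre_trunc (r : ℕ) {y : MvPolynomial (S × ℕ) (Rpi P)}
    (hy : y ∈ MvPolynomial.supported (Rpi P) {s : S × ℕ | s.2 ≤ r}) :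
    comparisonPre S P r (truncOrder r y) = evalTensor S P r (subPi P y) := by
  rw [MvPolynomial.supported] at hy
  induction hy using Algebra.adjoin_induction with
  | mem x hx =>
    obtain ⟨s, hs, rfl⟩ := hx
    have hs' : s.2 < r + 1 := Nat.lt_succ_of_le hs
    rw [truncOrder, MvPolynomial.aeval_X, dif_pos hs', comparisonPre, MvPolynomial.aeval_X,
      subPi, MvPolynomial.aeval_X]
  | algebraMap c => simp only [AlgHom.commutes]
  | add x y _ _ hx hy => simp only [map_add, hx, hy]
  | mul x y _ _ hx hy => simp only [map_mul, hx, hy]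

theorem comparisonPre_jetIdeal (r : ℕ) :
    jetIdeal (basePi P) (relPi S P) r ≤ RingHom.ker (comparisonPre S P r) := by
  rw [jetIdeal, Ideal.span_le]
  rintro _ ⟨_, ⟨f, hf, rfl⟩, i, hi, rfl⟩
  rw [SetLike.mem_coe, RingHom.mem_ker, comparisonPre_trunc, subPi_delta, subPi_emb]
  · exact evalTensor_rel S P r hf hi
  · have hsub : {s : S × ℕ | s.2 ≤ i} ⊆ {s : S × ℕ | s.2 ≤ r} := by
      intro s hs
      simp only [Set.mem_ofPred_eq] at hs ⊢
      exact hs.trans hi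
    exact MvPolynomial.supported_mono hsub
      (delta_iterate_supported (basePi P) dvd_rfl (emb_supported _) i)

/-- The canonical morphism of `δ_π`-prolongation sequences, before completion:
`δ_π^i a ↦ δ_π^i (1 ⊗ a)` for `a ∈ S`. -/
def comparison (r : ℕ) : JetPi S P r →ₐ[Rpi P] Rpi P ⊗[Rp p] JetP p S r :=
  Ideal.Quotient.liftₐ (jetIdeal (basePi P) (relPi S P) r) (comparisonPre S P r)
    (fun _ hx => comparisonPre_jetIdeal S P r hx)

end Jets

/-! ## Completeness of `R_π ⊗ S^r_p` and the comparison map on completions -/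

section Completion

/-- `M` is `p`-adically separated and complete. -/
def PComplete (p : ℕ) (M : Type*) [AddCommGroup M] : Prop :=
  (∀ x : M, (∀ n, ∃ y : M, x = p ^ n • y) → x = 0) ∧
  ∀ f : ℕ → M, (∀ m n, m ≤ n → ∃ y : M, f m - f n = p ^ m • y) →
    ∃ L : M, ∀ n, ∃ y : M, f n - L = p ^ n • y

theorem mem_span_pow_smul_top {p : ℕ} {A M : Type*} [CommRing A] [AddCommGroup M] [Module A M]
    (n : ℕ) (x : M) :
    x ∈ ((Ideal.span {(p : A)}) ^ n • ⊤ : Submodule A M) ↔ ∃ y : M, x = p ^ n • y := by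
  rw [Ideal.span_singleton_pow, Submodule.ideal_span_singleton_smul,
    Submodule.mem_smul_pointwise_iff_exists]
  constructor
  · rintro ⟨y, -, rfl⟩
    exact ⟨y, by rw [← Nat.cast_pow, Nat.cast_smul_eq_nsmul]⟩
  · rintro ⟨y, rfl⟩
    exact ⟨y, trivial, by rw [← Nat.cast_pow, Nat.cast_smul_eq_nsmul]⟩

theorem isAdicComplete_iff_pComplete {p : ℕ} {A M : Type*} [CommRing A] [AddCommGroup M]
    [Module A M] : IsAdicComplete (Ideal.span {(p : A)}) M ↔ PComplete p M := by
  constructor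
  · intro h
    refine ⟨fun x hx => h.toIsHausdorff.haus' x fun n => ?_, fun f hf => ?_⟩
    · rw [SModEq.sub_mem, sub_zero, mem_span_pow_smul_top]
      exact hx n
    · obtain ⟨L, hL⟩ := h.toIsPrecomplete.prec' f (fun {m n} hmn => by
        rw [SModEq.sub_mem, mem_span_pow_smul_top]
        exact hf m n hmn)
      refine ⟨L, fun n => ?_⟩
      have := hL n
      rwa [SModEq.sub_mem, mem_span_pow_smul_top] at this
  · rintro ⟨h1, h2⟩
    refine { haus' := fun x hx => h1 x fun n => ?_, prec' := fun f hf => ?_ }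
    · have := hx n
      rwa [SModEq.sub_mem, sub_zero, mem_span_pow_smul_top] at this
    · obtain ⟨L, hL⟩ := h2 f (fun m n hmn => by
        have := hf hmn
        rwa [SModEq.sub_mem, mem_span_pow_smul_top] at this)
      refine ⟨L, fun n => ?_⟩
      rw [SModEq.sub_mem, mem_span_pow_smul_top]
      exact hL n

theorem PComplete.pi {p : ℕ} {M ι : Type*} [AddCommGroup M] (h : PComplete p M) :
    PComplete p (ι → M) := by
  refine ⟨fun x hx => funext fun i => h.1 _ fun n => ?_, fun f hf => ?_⟩
  · obtain ⟨y, hy⟩ := hx n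
    exact ⟨y i, congrFun hy i⟩
  · have : ∀ i, ∃ L : M, ∀ n, ∃ y : M, f n i - L = p ^ n • y := fun i =>
      h.2 (fun n => f n i) fun m n hmn => by
        obtain ⟨y, hy⟩ := hf m n hmn
        exact ⟨y i, congrFun hy i⟩
    choose L hL using this
    refine ⟨L, fun n => ?_⟩
    choose y hy using fun i => hL i n
    exact ⟨y, funext hy⟩

theorem PComplete.equiv {p : ℕ} {M N : Type*} [AddCommGroup M] [AddCommGroup N] (e : M ≃+ N)
    (h : PComplete p M) : PComplete p N := by
  refine ⟨fun x hx => ?_, fun f hf => ?_⟩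
  · have : e.symm x = 0 := h.1 _ fun n => by
      obtain ⟨y, hy⟩ := hx n
      exact ⟨e.symm y, by rw [hy, map_nsmul]⟩
    simpa using this
  · obtain ⟨L, hL⟩ := h.2 (fun n => e.symm (f n)) fun m n hmn => by
      obtain ⟨y, hy⟩ := hf m n hmn
      exact ⟨e.symm y, by rw [← map_sub, hy, map_nsmul]⟩
    refine ⟨e L, fun n => ?_⟩
    obtain ⟨y, hy⟩ := hL n
    refine ⟨e y, ?_⟩
    have := congrArg e hy
    simpa using this

theorem span_pow_le_comap (p : ℕ) {A E : Type*} [CommRing A] [CommRing E] (f : A →+* E) (n : ℕ) :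
    (Ideal.span {(p : A)}) ^ n ≤ ((Ideal.span {(p : E)}) ^ n).comap f := by
  rw [← Ideal.map_le_iff_le_comap, Ideal.map_pow, Ideal.map_span, Set.image_singleton,
    map_natCast]

/-- The extension of a ring homomorphism `A → E` to the `p`-adic completion of `A`, for a
`p`-adically complete ring `E`. -/
def liftCompletion (p : ℕ) {A E : Type*} [CommRing A] [CommRing E]
    [IsAdicComplete (Ideal.span {(p : E)}) E] (f : A →+* E) :
    AdicCompletion (Ideal.span {(p : A)}) A →+* E :=
  IsAdicComplete.liftRingHom (Ideal.span {(p : E)})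
    (fun n => (Ideal.quotientMap ((Ideal.span {(p : E)}) ^ n) f (span_pow_le_comap p f n)).comp
      (AdicCompletion.evalₐ (Ideal.span {(p : A)}) n).toRingHom)
    (by
      intro m n hmn
      ext x
      induction x using AdicCompletion.induction_on with
      | _ a =>
        have h := AdicCompletion.Ideal.mk_eq_mk (Ideal.span {(p : A)}) hmn a
        simp only [AlgHom.toRingHom_eq_coe, RingHom.comp_apply, RingHom.coe_coe,
          AdicCompletion.evalₐ_mk, Ideal.quotientMap_mk]
        change Ideal.Quotient.mk (Ideal.span {(p : E)} ^ m) _ = Ideal.Quotient.mk _ _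
        rw [Ideal.Quotient.eq] at h ⊢
        rw [← map_sub]
        exact span_pow_le_comap p f m h)

variable {p : ℕ} [Fact p.Prime] (S : Type u) [CommRing S] [Algebra (Rp p) S]
  (P : EisensteinPoly p)

instance isAdicComplete_spTensor (r : ℕ) :
    IsAdicComplete (Ideal.span {(p : SpTensor S P r)}) (SpTensor S P r) := by
  rw [isAdicComplete_iff_pComplete]
  have h1 : PComplete p (Sp p S r) :=
    (isAdicComplete_iff_pComplete (A := JetP p S r)).1
      (AdicCompletion.isAdicComplete ⟨{(p : JetP p S r)}, by simp⟩)
  let b := (AdjoinRoot.powerBasis' P.polyR_monic).basis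
  let e : Rpi P ⊗[Rp p] Sp p S r ≃ₗ[Rp p] (_ → Sp p S r) :=
    (TensorProduct.comm _ _ _).trans ((TensorProduct.congr (LinearEquiv.refl _ _) b.equivFun).trans
      (TensorProduct.piScalarRight (Rp p) (Rp p) (Sp p S r) _))
  exact h1.pi.equiv e.symm.toAddEquiv

/-- The canonical map `S^r_π → R_π ⊗ S^r_p`. -/
def tra (r : ℕ) : Spi S P r →+* SpTensor S P r :=
  liftCompletion p ((Algebra.TensorProduct.map (AlgHom.id (Rp p) (Rpi P))
    (Algebra.ofId (JetP p S r) (Sp p S r) |>.restrictScalars (Rp p))).toRingHom.comp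
      (comparison S P r).toRingHom)

end Completion

/-! ## Power series in `T, δT, …, δ^r T` -/

section Series

/-- Setting `T = 0`: the variable `(j, 0)`, i.e. `T_j`, goes to `0`, and `(j, i + 1)`, i.e.
`δ^(i+1) T_j`, goes to the variable `(j, i)` of a series in `δT, …, δ^r T`. (Only variables of
order `≤ r` occur where this is used.) -/
def tailVar (r : ℕ) {J R : Type*} [CommRing R] : J × ℕ → MvPolynomial (J × Fin r) R
  | (_, 0) => 0
  | (j, i + 1) => if h : i < r then MvPolynomial.X (j, ⟨i, h⟩) else 0

/-- `f ↦ f|_{T = 0}` for polynomials. -/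
def setZeroPoly (r : ℕ) {J R : Type*} [CommRing R] :
    MvPolynomial (J × ℕ) R →ₐ[R] MvPolynomial (J × Fin r) R :=
  MvPolynomial.aeval (tailVar r)

/-- `f ↦ f|_{T = 0}` for power series. -/
def setZero (r : ℕ) {J R : Type*} [CommRing R] (f : MvPowerSeries (J × ℕ) R) :
    MvPowerSeries (J × Fin r) R :=
  f.subst fun s => ((tailVar r s : MvPolynomial (J × Fin r) R) : MvPowerSeries (J × Fin r) R)

theorem constantCoeff_setZeroPoly (r : ℕ) {J R : Type*} [CommRing R]
    (f : MvPolynomial (J × ℕ) R) :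
    MvPolynomial.constantCoeff (setZeroPoly r f) = MvPolynomial.constantCoeff f := by
  induction f using MvPolynomial.induction_on with
  | C a => simp [setZeroPoly]
  | add f g hf hg => rw [map_add, map_add, map_add, hf, hg]
  | mul_X f s hf =>
    rw [map_mul, map_mul, map_mul, hf, MvPolynomial.constantCoeff_X, mul_zero]
    have : MvPolynomial.constantCoeff (setZeroPoly r (MvPolynomial.X s : MvPolynomial (J × ℕ) R))
        = 0 := by
      rw [setZeroPoly, MvPolynomial.aeval_X]
      rcases s with ⟨j, _ | i⟩
      · simp [tailVar]
      · simp only [tailVar]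
        split_ifs <;> simp
    rw [this, mul_zero]

/-- A power series over `A` is restricted if its coefficients tend to `0` `p`-adically. For a
`p`-adically complete `A` the restricted series in variables `x` form the `p`-adic completion of
`A[x]`. -/
def IsRestricted (p : ℕ) {σ A : Type*} [CommRing A] (f : MvPowerSeries σ A) : Prop :=
  ∀ m : ℕ, {d : σ →₀ ℕ | MvPowerSeries.coeff d f ∉ Ideal.span {(p : A) ^ m}}.Finite

variable {p : ℕ} [Fact p.Prime] (S : Type u) [CommRing S] [Algebra (Rp p) S]
  (P : EisensteinPoly p)

/-- The image of `δ_π^(i+1) T_j` in `(R_π ⊗ S^r_p)[δ_p T, …, δ_p^r T]`, for `s = (j, i)`. -/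
def deltaPiT (r : ℕ) {J : Type*} (s : J × Fin r) :
    MvPowerSeries (J × Fin r) (SpTensor S P r) :=
  (MvPolynomial.map (algebraMap (Rpi P) (SpTensor S P r))
    (setZeroPoly r (deltaPiVar P s.1 (s.2 + 1))) : MvPolynomial (J × Fin r) (SpTensor S P r))

theorem hasSubst_deltaPiT (r : ℕ) {J : Type*} [Finite J] :
    MvPowerSeries.HasSubst (deltaPiT S P r (J := J)) := by
  refine MvPowerSeries.hasSubst_of_constantCoeff_zero fun s => ?_
  have h : MvPolynomial.constantCoeff (setZeroPoly r (deltaPiVar P s.1 (s.2 + 1))) = 0 := by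
    rw [constantCoeff_setZeroPoly]
    exact constantCoeff_delta_iterate (basePi P) (basePi P).dvd_p _ _
  rw [deltaPiT, ← MvPowerSeries.coeff_zero_eq_constantCoeff_apply, MvPolynomial.coeff_coe,
    MvPolynomial.coeff_map, ← MvPolynomial.constantCoeff_eq, h, map_zero]

/-- The natural homomorphism `S^r_π[[δ_π T, …, δ_π^r T]] → (R_π ⊗ S^r_p)[[δ_p T, …, δ_p^r T]]`
for a tuple `T = (T_j)`; its restriction to restricted power series is the natural homomorphism
`S^r_π[δ_π T, …, δ_π^r T]^ → (R_π ⊗ S^r_p)[δ_p T, …, δ_p^r T]^`. -/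
def natHom (r : ℕ) (J : Type*) [Finite J] :
    MvPowerSeries (J × Fin r) (Spi S P r) →+* MvPowerSeries (J × Fin r) (SpTensor S P r) :=
  (MvPowerSeries.substAlgHom (R := SpTensor S P r)
    (hasSubst_deltaPiT S P r (J := J))).toRingHom.comp (MvPowerSeries.map (tra S P r))

variable {S}

/-- The `p`-derivation's ring homomorphism `φ` on power series in `T, δ_p T, δ_p² T, …` with
coefficients in the polynomial ring `R_p[x_a, δ_p x_a, … : a ∈ S]`. -/
def PhiSeries {J : Type*} (f : MvPowerSeries (J × ℕ) (MvPolynomial (S × ℕ) (Rp p))) :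
    MvPowerSeries (J × ℕ) (MvPolynomial (S × ℕ) (Rp p)) :=
  (f.map (Phi (baseP p) (baseP p).ϖ)).subst fun s =>
    (MvPowerSeries.X s ^ p + (p : MvPowerSeries (J × ℕ) (MvPolynomial (S × ℕ) (Rp p)))
      * MvPowerSeries.X (s.1, s.2 + 1))

open Classical in
/-- The `p`-derivation `f ↦ (φ(f) - f^p) / p` on the same (torsion free) power series ring. -/
def deltaSeries {J : Type*} (f : MvPowerSeries (J × ℕ) (MvPolynomial (S × ℕ) (Rp p))) :
    MvPowerSeries (J × ℕ) (MvPolynomial (S × ℕ) (Rp p)) :=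
  if h : ∃ g : MvPowerSeries (J × ℕ) (MvPolynomial (S × ℕ) (Rp p)), p * g = PhiSeries f - f ^ p
  then h.choose else 0

theorem hasSubst_PhiSeries {A J : Type*} [CommRing A] :
    MvPowerSeries.HasSubst fun s : J × ℕ =>
      (MvPowerSeries.X s ^ p + (p : MvPowerSeries (J × ℕ) A) * MvPowerSeries.X (s.1, s.2 + 1)) := by
  refine (MvPowerSeries.HasSubst.X_pow (Fact.out : p.Prime).ne_zero).add
    (MvPowerSeries.HasSubst.mul_left _ ?_)
  refine ⟨fun s => by simp, fun d => ?_⟩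
  classical
  have hinj : Function.Injective fun s : J × ℕ => (s.1, s.2 + 1) := by
    rintro ⟨a, i⟩ ⟨b, j⟩ h
    simpa using h
  refine Set.Finite.subset (((MvPowerSeries.HasSubst.X (σ := J × ℕ) (S := A)).coeff_zero d).preimage
    hinj.injOn) ?_
  intro s hs
  exact hs

/-- The division in the definition of `deltaSeries` is always possible. -/
theorem deltaSeries_spec {J S : Type*} (f : MvPowerSeries (J × ℕ) (MvPolynomial (S × ℕ) (Rp p))) :
    p * deltaSeries f = PhiSeries f - f ^ p := by
  classical
  suffices h : ∃ g : MvPowerSeries (J × ℕ) (MvPolynomial (S × ℕ) (Rp p)),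
      p * g = PhiSeries f - f ^ p by
    rw [deltaSeries, dif_pos h]
    exact h.choose_spec
  let I : Ideal (MvPolynomial (S × ℕ) (Rp p)) := Ideal.span {(p : MvPolynomial (S × ℕ) (Rp p))}
  let q := Ideal.Quotient.mk I
  have hq0 : ((p : ℕ) : MvPolynomial (S × ℕ) (Rp p) ⧸ I) = 0 := by
    rw [← map_natCast q]
    exact Ideal.Quotient.eq_zero_iff_mem.2 (Ideal.mem_span_singleton_self _)
  suffices h : (PhiSeries f - f ^ p).map q = 0 by
    have hd : ∀ d, ∃ c, MvPowerSeries.coeff d (PhiSeries f - f ^ p) = p * c := fun d => by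
      have := congrArg (MvPowerSeries.coeff d) h
      rw [MvPowerSeries.coeff_map, map_zero] at this
      exact Ideal.mem_span_singleton.1 (Ideal.Quotient.eq_zero_iff_mem.1 this)
    choose c hc using hd
    let g : MvPowerSeries (J × ℕ) (MvPolynomial (S × ℕ) (Rp p)) := fun d => c d
    have hg : ∀ d, MvPowerSeries.coeff d g = c d := fun d => rfl
    refine ⟨g, ?_⟩
    ext1 d
    rw [hc, ← map_natCast (MvPowerSeries.C (σ := J × ℕ)), MvPowerSeries.coeff_C_mul, hg]
  rcases subsingleton_or_nontrivial (MvPolynomial (S × ℕ) (Rp p) ⧸ I) with hsub | hnon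
  · ext d
    exact Subsingleton.elim _ _
  have : CharP (MvPolynomial (S × ℕ) (Rp p) ⧸ I) p :=
    ringChar.of_eq (CharP.ringChar_of_prime_eq_zero (Fact.out : p.Prime) hq0)
  have : ExpChar (MvPolynomial (S × ℕ) (Rp p) ⧸ I) p := ExpChar.prime Fact.out
  have hcomp : q.comp (Phi (baseP p) (baseP p).ϖ) = (frobenius _ p).comp q := by
    refine RingHom.ext fun g => ?_
    have := delta_spec (baseP p) dvd_rfl g
    rw [RingHom.comp_apply, RingHom.comp_apply, frobenius_def, ← map_pow, ← sub_eq_zero, ← map_sub,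
      ← this, map_mul]
    have h0 : q (MvPolynomial.C (baseP p).ϖ) = 0 := by
      simp [baseP]
    rw [h0, zero_mul]
  rw [map_sub, map_pow, PhiSeries, MvPowerSeries.map_subst hasSubst_PhiSeries,
    ← MvPowerSeries.map_frobenius_expand (p := p) (hp := (Fact.out : p.Prime).ne_zero), sub_eq_zero,
    MvPowerSeries.map_expand, MvPowerSeries.expand, MvPowerSeries.substAlgHom_apply]
  have h1 : ((f.map (Phi (baseP p) (baseP p).ϖ)).map q) = ((f.map q).map (frobenius _ p)) := by
    ext1 d
    simp only [MvPowerSeries.coeff_map]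
    exact congrArg (fun g => g (MvPowerSeries.coeff d f)) hcomp
  have h2 : (p : MvPowerSeries (J × ℕ) (MvPolynomial (S × ℕ) (Rp p) ⧸ I)) = 0 := by
    rw [← map_natCast (MvPowerSeries.C (σ := J × ℕ)), hq0, map_zero]
  rw [h1]
  congr 1
  funext s
  simp [h2]

/-- The tautological lift `∑ x_{a_α} T^α` of a series `∑ a_α T^α` over `S`. -/
def liftSeries (p : ℕ) [Fact p.Prime] {J : Type*} (f : MvPowerSeries J S) :
    MvPowerSeries (J × ℕ) (MvPolynomial (S × ℕ) (Rp p)) :=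
  MvPowerSeries.subst (fun j => (MvPowerSeries.X (j, 0) :
      MvPowerSeries (J × ℕ) (MvPolynomial (S × ℕ) (Rp p))))
    (fun d => MvPolynomial.X (MvPowerSeries.coeff d f, 0) :
      MvPowerSeries J (MvPolynomial (S × ℕ) (Rp p)))

/-- The projection `R_p[x_a, δ_p x_a, … : a ∈ S] → S^r_p`, `δ_p^i x_a ↦ δ_p^i a` (for polynomials
of order `≤ r`). -/
def toSp (S : Type u) [CommRing S] [Algebra (Rp p) S] (r : ℕ) :
    MvPolynomial (S × ℕ) (Rp p) →+* Sp p S r :=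
  (algebraMap (JetP p S r) (Sp p S r)).comp (toJet (baseP p) (relP p S) r).toRingHom

/-- `{δ_p^r f}|_{T = 0}` for a power series `f` over `S`. The projection `toSp` from the torsion
free rings `R_p[x_a, …, δ_p^r x_a]` is compatible with the `p`-derivations, so `δ_p^r f` is the
image of `δ_p^r` of any lift of `f`. -/
def jetSeries (p : ℕ) [Fact p.Prime] {J S : Type*} [CommRing S] [Algebra (Rp p) S]
    (r : ℕ) (f : MvPowerSeries J S) : MvPowerSeries (J × Fin r) (Sp p S r) :=
  setZero r ((deltaSeries^[r] (liftSeries p f)).map (toSp S r))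

/-- `ℚ ⊗ A`. -/
def RatTensor (A : Type*) [CommRing A] : Type _ := ℚ ⊗[ℤ] A

instance (A : Type*) [CommRing A] : CommRing (RatTensor A) :=
  inferInstanceAs (CommRing (ℚ ⊗[ℤ] A))

instance (A : Type*) [CommRing A] : Algebra ℚ (RatTensor A) :=
  inferInstanceAs (Algebra ℚ (ℚ ⊗[ℤ] A))

/-- The canonical map `A → ℚ ⊗ A`. -/
def toRat (A : Type*) [CommRing A] : A →+* RatTensor A :=
  (Algebra.TensorProduct.includeRight : A →ₐ[ℤ] ℚ ⊗[ℤ] A).toRingHom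

/-- Functoriality of `ℚ ⊗ A`. -/
def ratMap {A B : Type*} [CommRing A] [CommRing B] (f : A →+* B) : RatTensor A →+* RatTensor B :=
  (Algebra.TensorProduct.map (AlgHom.id ℤ ℚ) f.toIntAlgHom).toRingHom

/-- The logarithm `l(T) = ∑ a_n T^n = ∫ dT / (∂F/∂X)(0, T)` of a formal group law `F(X, Y)`. -/
def formalLog {S : Type*} [CommRing S] (F : FormalGroup S) : PowerSeries (RatTensor S) :=
  PowerSeries.mk fun n => (1 / n : ℚ) • toRat S (PowerSeries.coeff (n - 1)
    (PowerSeries.invOfUnit (PowerSeries.mk fun k =>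
      MvPowerSeries.coeff (Finsupp.single 0 1 + Finsupp.single 1 k) F.toPowerSeries) 1))

/-- `φ^r(T)`, a polynomial in `T, δ_p T, …, δ_p^r T`, over `ℚ ⊗ S^r_p`. -/
def phiT (p : ℕ) [Fact p.Prime] (S : Type u) [CommRing S] [Algebra (Rp p) S] (r : ℕ) :
    MvPowerSeries (Unit × ℕ) (RatTensor (Sp p S r)) :=
  (MvPolynomial.map ((toRat (Sp p S r)).comp (algebraMap (Rp p) (Sp p S r)))
    ((Phi (baseP p) (baseP p).ϖ)^[r] (MvPolynomial.X ((), 0))) :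
      MvPolynomial (Unit × ℕ) (RatTensor (Sp p S r)))

/-- `φ^r : S → S^r_p`. -/
def phiSp (p : ℕ) [Fact p.Prime] (S : Type u) [CommRing S] [Algebra (Rp p) S] (r : ℕ) :
    S →+* Sp p S r :=
  (algebraMap (JetP p S r) (Sp p S r)).comp (phiJet p S r)

/-- `L^r_p = (1/p) {φ^r(l(T))}|_{T = 0}`, where `l` is the logarithm of `F`. -/
def Lp (p : ℕ) [Fact p.Prime] {S : Type u} [CommRing S] [Algebra (Rp p) S] (F : FormalGroup S)
    (r : ℕ) : MvPowerSeries (Unit × Fin r) (RatTensor (Sp p S r)) :=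
  (1 / p : ℚ) • setZero r
    (PowerSeries.subst (phiT p S r) ((formalLog F).map (ratMap (phiSp p S r))))

/-- The inclusion `S^r_p → R_π ⊗ S^r_p`. -/
def inclTensor (S : Type u) [CommRing S] [Algebra (Rp p) S] (P : EisensteinPoly p) (r : ℕ) :
    Sp p S r →+* SpTensor S P r :=
  (Algebra.TensorProduct.includeRight : Sp p S r →ₐ[Rp p] Rpi P ⊗[Rp p] Sp p S r).toRingHom

/-- `L^r_π = (p/π) L^r_p`, over `ℚ ⊗ (R_π ⊗ S^r_p)`. -/
def Lpi {S : Type u} [CommRing S] [Algebra (Rp p) S] (F : FormalGroup S) (P : EisensteinPoly p)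
    (r : ℕ) : MvPowerSeries (Unit × Fin r) (RatTensor (SpTensor S P r)) :=
  MvPowerSeries.C (toRat (SpTensor S P r) (algebraMap (Rpi P) (SpTensor S P r) (pDivPi P))) *
    (Lp p F r).map (ratMap (inclTensor S P r))

end Series

end PiJet

end

/-!
Since `p δ_p f = φ(f) - f ^ p`, some multiple `p^n δ_p^r f` is an integral polynomial in the
Frobenius powers `φ^i(f)`, `i ≤ r`. As `φ(x) = x^p + π δ_π x`, one has `φ^i(T_j)|_{T = 0} = π Q_j`
with `Q_j` a polynomial in the `δ_π^k T`, so `φ^i(f)|_{T = 0} = ∑ π^|d| φ^i(a_d) Q^d` for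
`f = ∑ a_d T^d`. The powers of `π` tend to `0` `p`-adically, hence this is the image under (∗) of a
restricted series.

The logarithm has the form `∑ ω_{n-1} T^n / n` with `ω_k ∈ S`, so `L^r_π` is treated in the same
way, with `π^n` replaced by `π^(n-1) / n`. If `v_p(π) ≥ 1 / (p - 1)`, then `p` divides `π^(p-1)`, so
these elements lie in `R_π` and still tend to `0`.
-/

noncomputable section

namespace PiJet

open Filter

universe u

/-! ## Restricted power series and substitution of polynomials -/

section Restricted

variable {p : ℕ} {σ A : Type*} [CommRing A]

theorem isRestricted_coe (y : MvPolynomial σ A) : IsRestricted p (y : MvPowerSeries σ A) := by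
  refine fun m => y.support.finite_toSet.subset fun d hd => ?_
  by_contra h
  refine hd ?_
  rw [MvPolynomial.coeff_coe, MvPolynomial.notMem_support_iff.1 h]
  exact zero_mem _

theorem IsRestricted.add {f g : MvPowerSeries σ A} (hf : IsRestricted p f)
    (hg : IsRestricted p g) : IsRestricted p (f + g) := by
  refine fun m => ((hf m).union (hg m)).subset fun d hd => ?_
  by_contra h
  simp only [Set.mem_union, Set.mem_ofPred_eq, not_or, not_not] at h
  exact hd (by rw [map_add]; exact add_mem h.1 h.2)

theorem IsRestricted.mul {f g : MvPowerSeries σ A} (hf : IsRestricted p f)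
    (hg : IsRestricted p g) : IsRestricted p (f * g) := by
  classical
  refine fun m => ((hf m).add (hg m)).subset fun d hd => ?_
  by_contra h
  refine hd ?_
  rw [MvPowerSeries.coeff_mul]
  refine sum_mem fun x hx => ?_
  by_cases h1 : MvPowerSeries.coeff x.1 f ∈ Ideal.span {(p : A) ^ m}
  · exact Ideal.mul_mem_right _ _ h1
  · refine Ideal.mul_mem_left _ _ (not_not.1 fun h2 => h ⟨x.1, h1, x.2, h2, ?_⟩)
    exact Finset.HasAntidiagonal.mem_antidiagonal.1 hx

/-- The subring of restricted power series. -/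
def restrictedSubring (p : ℕ) (σ A : Type*) [CommRing A] : Subring (MvPowerSeries σ A) where
  carrier := {f | IsRestricted p f}
  mul_mem' := IsRestricted.mul
  one_mem' := by simpa using isRestricted_coe (p := p) (1 : MvPolynomial σ A)
  add_mem' := IsRestricted.add
  zero_mem' := by simpa using isRestricted_coe (p := p) (0 : MvPolynomial σ A)
  neg_mem' {f} hf m := by simpa only [map_neg, neg_mem_iff] using hf m

/-- The power series with prescribed coefficients. -/
def ofCoeff (a : (σ →₀ ℕ) → A) : MvPowerSeries σ A := a

@[simp]
theorem coeff_ofCoeff (a : (σ →₀ ℕ) → A) (d : σ →₀ ℕ) :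
    MvPowerSeries.coeff d (ofCoeff a) = a d := rfl

theorem map_ofCoeff {B : Type*} [CommRing B] (f : A →+* B) (a : (σ →₀ ℕ) → A) :
    (ofCoeff a).map f = ofCoeff fun d => f (a d) := by
  ext d
  simp only [MvPowerSeries.coeff_map, coeff_ofCoeff]

theorem isRestricted_ofCoeff_degree_mul [Finite σ] {c : ℕ → A}
    (hc : ∀ m, ∀ᶠ n in atTop, (p : A) ^ m ∣ c n) (a : (σ →₀ ℕ) → A) :
    IsRestricted p (ofCoeff fun d => c d.degree * a d) := by
  intro m
  obtain ⟨N, hN⟩ := eventually_atTop.1 (hc m)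
  refine (Finsupp.finite_of_degree_lt N).subset fun d hd => ?_
  by_contra hle
  exact hd (Ideal.mul_mem_right _ _ (Ideal.mem_span_singleton.2 (hN _ (not_lt.1 hle))))

end Restricted

section SubstPoly

variable {K σ τ R R' A B : Type*} [CommRing R] [CommRing R'] [CommRing A] [CommRing B]
  (κ : R →+* A) {w : K → MvPolynomial σ R}

/-- The power series `g(w)` over `A`, for polynomials `w` over `R` and a ring homomorphism
`κ : R → A`. -/
def substPoly (w : K → MvPolynomial σ R) (g : MvPowerSeries K A) : MvPowerSeries σ A :=
  g.subst fun k => (MvPolynomial.map κ (w k) : MvPowerSeries σ A)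

theorem map_coe (y : MvPolynomial σ R) :
    (y : MvPowerSeries σ R).map κ = (MvPolynomial.map κ y : MvPolynomial σ A) := by
  ext d
  simp only [MvPowerSeries.coeff_map, MvPolynomial.coeff_coe, MvPolynomial.coeff_map]

theorem coe_finsuppProd (v : K → MvPolynomial σ A) (d : K →₀ ℕ) :
    (d.prod fun k e => (v k : MvPowerSeries σ A) ^ e)
      = ((d.prod fun k e => v k ^ e : MvPolynomial σ A) : MvPowerSeries σ A) := by
  simpa only [map_pow, MvPolynomial.coeToMvPowerSeries.ringHom_apply] using
    (map_finsuppProd (MvPolynomial.coeToMvPowerSeries.ringHom (R := A)) d fun k e => v k ^ e).symm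

theorem subst_coe_coe (v : σ → MvPolynomial τ A) (y : MvPolynomial σ A) :
    (y : MvPowerSeries σ A).subst (fun s => (v s : MvPowerSeries τ A))
      = (MvPolynomial.aeval v y : MvPolynomial τ A) := by
  rw [MvPowerSeries.subst_coe]
  exact (MvPolynomial.comp_aeval_apply v (MvPolynomial.coeToMvPowerSeries.algHom A) y).symm

theorem map_aeval (v : σ → MvPolynomial τ R) (y : MvPolynomial σ R) :
    MvPolynomial.map κ (MvPolynomial.aeval v y)
      = MvPolynomial.aeval (fun s => MvPolynomial.map κ (v s)) (MvPolynomial.map κ y) := by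
  induction y using MvPolynomial.induction_on with
  | C a => simp
  | add x y hx hy => simp only [map_add, hx, hy]
  | mul_X x s hx => simp only [map_mul, hx, MvPolynomial.aeval_X, MvPolynomial.map_X]

theorem hasSubst_map_coe [Finite K] (hw : ∀ k, MvPolynomial.constantCoeff (w k) = 0) :
    MvPowerSeries.HasSubst fun k => (MvPolynomial.map κ (w k) : MvPowerSeries σ A) :=
  MvPowerSeries.hasSubst_of_constantCoeff_zero fun k => by
    rw [← MvPowerSeries.coeff_zero_eq_constantCoeff_apply, MvPolynomial.coeff_coe,
      ← MvPolynomial.constantCoeff_eq, MvPolynomial.constantCoeff_map, hw, map_zero]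

theorem substPoly_map (ψ : R' →+* R) (w : K → MvPolynomial σ R') (g : MvPowerSeries K A) :
    substPoly κ (fun k => MvPolynomial.map ψ (w k)) g = substPoly (κ.comp ψ) w g := by
  simp only [substPoly, MvPolynomial.map_map]

variable [Finite K] (hw : ∀ k, MvPolynomial.constantCoeff (w k) = 0)
include hw

theorem map_substPoly (f : A →+* B) (g : MvPowerSeries K A) :
    (substPoly κ w g).map f = substPoly (f.comp κ) w (g.map f) := by
  simp only [substPoly, MvPowerSeries.map_subst (hasSubst_map_coe κ hw), map_coe,
    MvPolynomial.map_map]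

theorem subst_substPoly {v : σ → MvPolynomial τ R}
    (hv : MvPowerSeries.HasSubst fun s => (MvPolynomial.map κ (v s) : MvPowerSeries τ A))
    (g : MvPowerSeries K A) :
    (substPoly κ w g).subst (fun s => (MvPolynomial.map κ (v s) : MvPowerSeries τ A))
      = substPoly κ (fun k => MvPolynomial.aeval v (w k)) g := by
  simp only [substPoly, MvPowerSeries.subst_comp_subst_apply (hasSubst_map_coe κ hw) hv,
    subst_coe_coe, map_aeval]

theorem substPoly_C_mul (c : R) (g : MvPowerSeries K A) :
    substPoly κ (fun k => MvPolynomial.C c * w k) g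
      = substPoly κ w (MvPowerSeries.rescale (fun _ => κ c) g) := by
  have hX : MvPowerSeries.HasSubst ((fun _ : K => κ c) • MvPowerSeries.X (R := A)) :=
    MvPowerSeries.hasSubst_of_constantCoeff_zero fun k => by
      rw [Pi.smul_apply', MvPowerSeries.smul_eq_C_mul, map_mul, MvPowerSeries.constantCoeff_X,
        mul_zero]
  rw [substPoly, substPoly, MvPowerSeries.rescale_eq_subst,
    MvPowerSeries.subst_comp_subst_apply hX (hasSubst_map_coe κ hw)]
  congr 1
  funext k
  rw [Pi.smul_apply', MvPowerSeries.subst_smul (hasSubst_map_coe κ hw),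
    MvPowerSeries.subst_X (hasSubst_map_coe κ hw), MvPowerSeries.smul_eq_C_mul, map_mul,
    MvPolynomial.map_C, MvPolynomial.coe_mul, MvPolynomial.coe_C]

theorem C_mul_substPoly (x : A) (g : MvPowerSeries K A) :
    MvPowerSeries.C x * substPoly κ w g = substPoly κ w (MvPowerSeries.C x * g) := by
  simp only [substPoly, ← MvPowerSeries.smul_eq_C_mul,
    MvPowerSeries.subst_smul (hasSubst_map_coe κ hw)]

theorem smul_substPoly {k : Type*} [CommSemiring k] [Algebra k A] (q : k)
    (g : MvPowerSeries K A) : q • substPoly κ w g = substPoly κ w (q • g) := by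
  rw [← algebraMap_smul A q, ← algebraMap_smul A q g, MvPowerSeries.smul_eq_C_mul,
    MvPowerSeries.smul_eq_C_mul, C_mul_substPoly κ hw]

theorem IsRestricted.substPoly {p : ℕ} {g : MvPowerSeries K A} (hg : IsRestricted p g) :
    IsRestricted p (substPoly κ w g) := by
  set v := fun k => MvPolynomial.map κ (w k)
  refine fun m => ((hg m).biUnion fun d _ =>
    (d.prod fun k e => v k ^ e).support.finite_toSet).subset fun e he => ?_
  by_contra h
  refine he ?_
  rw [PiJet.substPoly, MvPowerSeries.coeff_subst (hasSubst_map_coe κ hw)]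
  refine finsum_induction (· ∈ Ideal.span {(p : A) ^ m}) (zero_mem _)
    (fun _ _ => add_mem) fun d => ?_
  rw [smul_eq_mul, coe_finsuppProd, MvPolynomial.coeff_coe]
  by_cases hd : MvPowerSeries.coeff d g ∈ Ideal.span {(p : A) ^ m}
  · exact Ideal.mul_mem_right _ _ hd
  · have h0 : MvPolynomial.coeff e (d.prod fun k e => v k ^ e) = 0 :=
      MvPolynomial.notMem_support_iff.1 fun hs => h (Set.mem_biUnion hd hs)
    rw [h0, mul_zero]
    exact zero_mem _

end SubstPoly

/-! ## Powers of the Frobenius lift -/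

section FrobVar

variable {p : ℕ} {R : Type*} [CommRing R] (B : FrobBase p R) {ι : Type*}

theorem setZeroPoly_X_zero (r : ℕ) (a : ι) :
    setZeroPoly r (MvPolynomial.X (a, 0) : MvPolynomial (ι × ℕ) R) = 0 := by
  rw [setZeroPoly, MvPolynomial.aeval_X, tailVar]

theorem setZeroPoly_X_succ {r i : ℕ} (hi : i < r) (a : ι) :
    setZeroPoly r (MvPolynomial.X (a, i + 1) : MvPolynomial (ι × ℕ) R)
      = MvPolynomial.X (a, ⟨i, hi⟩) := by
  rw [setZeroPoly, MvPolynomial.aeval_X, tailVar, dif_pos hi]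

theorem map_tailVar {R' : Type*} [CommRing R'] (f : R →+* R') (r : ℕ) (s : ι × ℕ) :
    MvPolynomial.map f (tailVar r s) = tailVar r s := by
  obtain ⟨a, _ | i⟩ := s
  · simp only [tailVar, map_zero]
  · simp only [tailVar]
    split_ifs <;> simp only [MvPolynomial.map_X, map_zero]

theorem map_setZeroPoly {R' : Type*} [CommRing R'] (f : R →+* R') (r : ℕ)
    (y : MvPolynomial (ι × ℕ) R) :
    MvPolynomial.map f (setZeroPoly r y) = setZeroPoly r (MvPolynomial.map f y) := by
  simp only [setZeroPoly, map_aeval, map_tailVar]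

theorem aeval_Phi_X_map (c : R) (y : MvPolynomial (ι × ℕ) R) :
    MvPolynomial.aeval (fun s => Phi B c (MvPolynomial.X s)) (MvPolynomial.map B.φ y)
      = Phi B c y := by
  induction y using MvPolynomial.induction_on with
  | C a => simp [Phi]
  | add x y hx hy => simp only [map_add, hx, hy]
  | mul_X x s hx => simp only [map_mul, hx, MvPolynomial.map_X, MvPolynomial.aeval_X]

/-- The `i`-th power `φ^i(x_a)` of the Frobenius lift applied to the variable `x_a`, as a
polynomial in `x_a, δ x_a, …, δ^i x_a`. -/
def frobVar (i : ℕ) (a : ι) : MvPolynomial (ι × ℕ) R :=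
  (Phi B B.ϖ)^[i] (MvPolynomial.X (a, 0))

theorem frobVar_zero (a : ι) : frobVar B 0 a = MvPolynomial.X (a, 0) := rfl

theorem frobVar_succ (i : ℕ) (a : ι) : frobVar B (i + 1) a = Phi B B.ϖ (frobVar B i a) :=
  Function.iterate_succ_apply' _ _ _

variable [Fact p.Prime]

theorem constantCoeff_Phi (c : R) (f : MvPolynomial (ι × ℕ) R) :
    MvPolynomial.constantCoeff (Phi B c f) = B.φ (MvPolynomial.constantCoeff f) := by
  have hφ : MvPolynomial.constantCoeff.comp (Phi B c (ι := ι))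
      = B.φ.comp MvPolynomial.constantCoeff := by
    refine MvPolynomial.ringHom_ext (fun a => ?_) fun s => ?_
    · simp [Phi]
    · simp [Phi, (Fact.out : p.Prime).ne_zero]
  exact RingHom.congr_fun hφ f

theorem constantCoeff_frobVar (i : ℕ) (a : ι) :
    MvPolynomial.constantCoeff (frobVar B i a) = 0 := by
  induction i with
  | zero => rw [frobVar_zero, MvPolynomial.constantCoeff_X]
  | succ i ih => rw [frobVar_succ, constantCoeff_Phi, ih, map_zero]

theorem C_dvd_setZeroPoly_frobVar (r i : ℕ) (a : ι) :
    MvPolynomial.C B.ϖ ∣ setZeroPoly r (frobVar B i a) := by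
  induction i with
  | zero => rw [frobVar_zero, setZeroPoly_X_zero]; exact dvd_zero _
  | succ i ih =>
    rw [frobVar_succ, Phi_eq B dvd_rfl, map_add, map_pow, map_mul, MvPolynomial.algHom_C,
      MvPolynomial.algebraMap_eq]
    exact dvd_add (dvd_pow ih (Fact.out : p.Prime).ne_zero) (dvd_mul_right _ _)

/-- The polynomial `φ^i(T_a)|_{T = 0} / ϖ` in `δT, …, δ^r T`. -/
def frobQuot (r i : ℕ) (a : ι) : MvPolynomial (ι × Fin r) R :=
  (C_dvd_setZeroPoly_frobVar B r i a).choose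

theorem C_mul_frobQuot (r i : ℕ) (a : ι) :
    MvPolynomial.C B.ϖ * frobQuot B r i a = setZeroPoly r (frobVar B i a) :=
  (C_dvd_setZeroPoly_frobVar B r i a).choose_spec.symm

variable [IsDomain R]

theorem frobVar_supported (i : ℕ) (a : ι) :
    frobVar B i a ∈ MvPolynomial.supported R {s : ι × ℕ | s.2 ≤ i} := by
  induction i with
  | zero => exact Algebra.subset_adjoin ⟨(a, 0), Nat.zero_le 0, rfl⟩
  | succ i ih =>
    rw [frobVar_succ, Phi_eq B dvd_rfl]
    have hmono : MvPolynomial.supported R {s : ι × ℕ | s.2 ≤ i}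
        ≤ MvPolynomial.supported R {s : ι × ℕ | s.2 ≤ i + 1} :=
      MvPolynomial.supported_mono fun _ hs => Nat.le_succ_of_le hs
    exact add_mem (pow_mem (hmono ih) p)
      (mul_mem (Subalgebra.algebraMap_mem _ B.ϖ) (delta_supported B dvd_rfl i ih))

theorem constantCoeff_frobQuot (r i : ℕ) (a : ι) :
    MvPolynomial.constantCoeff (frobQuot B r i a) = 0 := by
  have h := congrArg MvPolynomial.constantCoeff (C_mul_frobQuot B r i a)
  rw [map_mul, constantCoeff_setZeroPoly, constantCoeff_frobVar, MvPolynomial.constantCoeff_C] at h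
  exact (mul_eq_zero.1 h).resolve_left B.ϖ_ne_zero

end FrobVar

/-! ## The natural homomorphism on Frobenius powers -/

section Comparison

theorem liftCompletion_algebraMap (p : ℕ) {A E : Type*} [CommRing A] [CommRing E]
    [IsAdicComplete (Ideal.span {(p : E)}) E] (f : A →+* E) (a : A) :
    liftCompletion p f (algebraMap A _ a) = f a := by
  refine (IsHausdorff.eq_iff_smodEq (I := Ideal.span {(p : E)})).2 fun n => ?_
  rw [smul_eq_mul, Ideal.mul_top, SModEq, Ideal.Quotient.mk_eq_mk, Ideal.Quotient.mk_eq_mk,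
    liftCompletion]
  generalize_proofs
  rename_i hf
  have ha : AdicCompletion.evalₐ (Ideal.span {(p : A)}) n (algebraMap A _ a)
      = Ideal.Quotient.mk _ a :=
    AlgHom.commutes _ a
  rw [IsAdicComplete.mk_liftRingHom _ _ (fun {m n} h => hf h), RingHom.comp_apply,
    AlgHom.toRingHom_eq_coe, RingHom.coe_coe, ha, Ideal.quotientMap_mk]

variable {p : ℕ} [Fact p.Prime] (S : Type u) [CommRing S] [Algebra (Rp p) S]
  (P : EisensteinPoly p)

theorem Phi_map {ι : Type*} (f : MvPolynomial (ι × ℕ) (Rp p)) :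
    Phi (basePi P) (p : Rpi P) (MvPolynomial.map (algebraMap (Rp p) (Rpi P)) f)
      = MvPolynomial.map (algebraMap (Rp p) (Rpi P)) (Phi (baseP p) (baseP p).ϖ f) := by
  have hp : MvPolynomial.C (basePi P).ϖ * MvPolynomial.C (pDivPi P)
      = (MvPolynomial.map (algebraMap (Rp p) (Rpi P)) (MvPolynomial.C (baseP p).ϖ) :
        MvPolynomial (ι × ℕ) (Rpi P)) := by
    rw [← map_mul, MvPolynomial.map_C]
    exact congrArg _ ((piR_mul_pDivPi P).trans (map_natCast _ p).symm)
  rw [Phi_eq (basePi P) (basePi P).dvd_p, delta_map, Phi_eq (baseP p) dvd_rfl, map_add, map_pow,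
    map_mul, ← mul_assoc, hp]

theorem subPi_frobVar {ι : Type*} (i : ℕ) (a : ι) :
    subPi P (frobVar (basePi P) i a)
      = MvPolynomial.map (algebraMap (Rp p) (Rpi P)) (frobVar (baseP p) i a) := by
  induction i with
  | zero =>
    rw [frobVar_zero, frobVar_zero, MvPolynomial.map_X, subPi, MvPolynomial.aeval_X]
    rfl
  | succ i ih => rw [frobVar_succ, frobVar_succ, subPi_Phi, ih, Phi_map]

/-- The element `φ^i(a)` of `S^r_p`, for `i ≤ r`. -/
def frobSp (r i : ℕ) (a : S) : Sp p S r :=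
  toSp S r (frobVar (baseP p) i a)

/-- The element `φ^i(a)` of `S^r_π`, for `i ≤ r`. -/
def frobSpi (r i : ℕ) (a : S) : Spi S P r :=
  algebraMap (JetPi S P r) (Spi S P r) (toJet (basePi P) (relPi S P) r (frobVar (basePi P) i a))

theorem phiSp_apply (r : ℕ) (a : S) : phiSp p S r a = frobSp S r r a := by
  refine congrArg (algebraMap (JetP p S r) (Sp p S r)) ?_
  have ha : a = (MvPolynomial.aeval (R := Rp p) (id : S → S)).toRingHom (MvPolynomial.X a) :=
    (MvPolynomial.aeval_X id a).symm
  conv_lhs => rw [ha]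
  rw [phiJet, RingHom.liftOfRightInverse_comp_apply]
  simp [emb, frobVar, RingHom.coe_pow]

theorem tra_algebraMap_jet (r : ℕ) (x : JetPi S P r) :
    tra S P r (algebraMap _ _ x) = (Algebra.TensorProduct.map (AlgHom.id (Rp p) (Rpi P))
      (Algebra.ofId (JetP p S r) (Sp p S r) |>.restrictScalars (Rp p))) (comparison S P r x) := by
  rw [tra, liftCompletion_algebraMap]
  rfl

theorem tra_comp_algebraMap (r : ℕ) :
    (tra S P r).comp (algebraMap (Rpi P) (Spi S P r)) = algebraMap (Rpi P) (SpTensor S P r) := by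
  refine RingHom.ext fun c => ?_
  change tra S P r (algebraMap (JetPi S P r) (Spi S P r) (algebraMap (Rpi P) (JetPi S P r) c)) = _
  rw [tra_algebraMap_jet, AlgHom.commutes, Algebra.TensorProduct.algebraMap_apply,
    Algebra.TensorProduct.algebraMap_apply, Algebra.TensorProduct.map_tmul, map_one]
  rfl

theorem tra_frobSpi {i r : ℕ} (hi : i ≤ r) (a : S) :
    tra S P r (frobSpi S P r i a) = inclTensor S P r (frobSp S r i a) := by
  have hsupp : frobVar (basePi P) i a ∈ MvPolynomial.supported (Rpi P) {s : S × ℕ | s.2 ≤ r} :=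
    MvPolynomial.supported_mono (fun _ hs => hs.trans hi) (frobVar_supported (basePi P) i a)
  have hjet : comparison S P r (toJet (basePi P) (relPi S P) r (frobVar (basePi P) i a))
      = comparisonPre S P r (truncOrder r (frobVar (basePi P) i a)) := rfl
  rw [frobSpi, tra_algebraMap_jet, hjet, comparisonPre_trunc S P r hsupp, subPi_frobVar,
    evalTensor_map, Algebra.TensorProduct.map_tmul]
  rfl

theorem inclTensor_comp_algebraMap (r : ℕ) :
    (inclTensor S P r).comp (algebraMap (Rp p) (Sp p S r))
      = (algebraMap (Rpi P) (SpTensor S P r)).comp (algebraMap (Rp p) (Rpi P)) := by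
  ext1 c
  rw [RingHom.comp_apply, RingHom.comp_apply, ← IsScalarTower.algebraMap_apply]
  exact AlgHom.commutes (Algebra.TensorProduct.includeRight : Sp p S r →ₐ[Rp p] _) c

/-- The substitution `δ_π^i T ↦ {δ_π^i T}|_{T = 0}`. -/
def subPiT (r : ℕ) {J : Type*} :
    MvPolynomial (J × Fin r) (Rpi P) →ₐ[Rpi P] MvPolynomial (J × Fin r) (Rpi P) :=
  MvPolynomial.aeval fun s => setZeroPoly r (deltaPiVar P s.1 (s.2 + 1))

theorem subPiT_setZeroPoly (r : ℕ) {J : Type*} {y : MvPolynomial (J × ℕ) (Rpi P)}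
    (hy : y ∈ MvPolynomial.supported (Rpi P) {s : J × ℕ | s.2 ≤ r}) :
    subPiT P r (setZeroPoly r y) = setZeroPoly r (subPi P y) := by
  rw [MvPolynomial.supported] at hy
  induction hy using Algebra.adjoin_induction with
  | mem x hx =>
    obtain ⟨⟨j, _ | i⟩, hs, rfl⟩ := hx
    · rw [setZeroPoly_X_zero, map_zero, subPi, MvPolynomial.aeval_X]
      exact (setZeroPoly_X_zero r j).symm
    · rw [setZeroPoly_X_succ (Nat.lt_of_succ_le hs), subPiT, subPi, MvPolynomial.aeval_X,
        MvPolynomial.aeval_X]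
  | algebraMap c => simp only [AlgHom.commutes]
  | add x y _ _ hx hy => simp only [map_add, hx, hy]
  | mul x y _ _ hx hy => simp only [map_mul, hx, hy]

theorem constantCoeff_subPiT (r : ℕ) {J : Type*} (y : MvPolynomial (J × Fin r) (Rpi P)) :
    MvPolynomial.constantCoeff (subPiT P r y) = MvPolynomial.constantCoeff y := by
  have hcoeff : MvPolynomial.constantCoeff.comp (subPiT P r (J := J)).toRingHom
      = MvPolynomial.constantCoeff := by
    refine MvPolynomial.ringHom_ext (fun a => ?_) fun s => ?_
    · simp [subPiT]
    · simp only [AlgHom.toRingHom_eq_coe, RingHom.comp_apply, RingHom.coe_coe, subPiT,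
        MvPolynomial.aeval_X, constantCoeff_setZeroPoly, MvPolynomial.constantCoeff_X]
      exact constantCoeff_delta_iterate (basePi P) (basePi P).dvd_p (s.1, 0) (s.2 + 1)
  exact RingHom.congr_fun hcoeff y

theorem natHom_substPoly (r : ℕ) {J K : Type*} [Finite J] [Finite K]
    {w : K → MvPolynomial (J × Fin r) (Rpi P)}
    (hw : ∀ k, MvPolynomial.constantCoeff (w k) = 0) (g : MvPowerSeries K (Spi S P r)) :
    natHom S P r J (substPoly (algebraMap (Rpi P) (Spi S P r)) w g)
      = substPoly (algebraMap (Rpi P) (SpTensor S P r)) (fun k => subPiT P r (w k))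
          (g.map (tra S P r)) := by
  rw [natHom, RingHom.comp_apply, map_substPoly _ hw, tra_comp_algebraMap, AlgHom.toRingHom_eq_coe,
    RingHom.coe_coe, MvPowerSeries.coe_substAlgHom]
  exact subst_substPoly _ hw (hasSubst_deltaPiT S P r) _

/-- The polynomial `φ^i(T_j)|_{T = 0} / π` in `δ_p T, …, δ_p^r T`, obtained from its analogue in
`δ_π T, …, δ_π^r T`. -/
def frobTail (r i : ℕ) {J : Type*} (j : J) : MvPolynomial (J × Fin r) (Rpi P) :=
  subPiT P r (frobQuot (basePi P) r i j)

theorem constantCoeff_frobTail (r i : ℕ) {J : Type*} (j : J) :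
    MvPolynomial.constantCoeff (frobTail P r i j) = 0 := by
  rw [frobTail, constantCoeff_subPiT, constantCoeff_frobQuot]

theorem C_mul_frobTail {i r : ℕ} (hi : i ≤ r) {J : Type*} (j : J) :
    MvPolynomial.C (piR P) * frobTail P r i j
      = MvPolynomial.map (algebraMap (Rp p) (Rpi P)) (setZeroPoly r (frobVar (baseP p) i j)) := by
  have hsupp : frobVar (basePi P) i j ∈ MvPolynomial.supported (Rpi P) {s : J × ℕ | s.2 ≤ r} :=
    MvPolynomial.supported_mono (fun _ hs => hs.trans hi) (frobVar_supported (basePi P) i j)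
  rw [map_setZeroPoly, ← subPi_frobVar, ← subPiT_setZeroPoly P r hsupp, ← C_mul_frobQuot, map_mul,
    MvPolynomial.algHom_C, MvPolynomial.algebraMap_eq]
  rfl

/-- The image of the natural homomorphism (∗). -/
def natHomImage (r : ℕ) (J : Type*) [Finite J] :
    Subring (MvPowerSeries (J × Fin r) (SpTensor S P r)) :=
  (restrictedSubring p (J × Fin r) (Spi S P r)).map (natHom S P r J)

theorem substPoly_frobTail_mem_natHomImage {i r : ℕ} (hi : i ≤ r) {J : Type*} [Finite J]
    {c : ℕ → Rpi P} (hc : ∀ m, ∀ᶠ n in atTop, (p : Rpi P) ^ m ∣ c n) (a : (J →₀ ℕ) → S) :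
    substPoly (algebraMap (Rpi P) (SpTensor S P r)) (frobTail P r i)
        (ofCoeff fun d => algebraMap _ _ (c d.degree) * inclTensor S P r (frobSp S r i (a d)))
      ∈ natHomImage S P r J := by
  have hc' (m : ℕ) : ∀ᶠ n in atTop, (p : Spi S P r) ^ m ∣ algebraMap _ (Spi S P r) (c n) :=
    (hc m).mono fun n h => by simpa using map_dvd (algebraMap (Rpi P) (Spi S P r)) h
  have hw := constantCoeff_frobQuot (basePi P) r i (ι := J)
  refine ⟨substPoly (algebraMap (Rpi P) (Spi S P r)) (frobQuot (basePi P) r i)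
    (ofCoeff fun d => algebraMap _ _ (c d.degree) * frobSpi S P r i (a d)),
    (isRestricted_ofCoeff_degree_mul hc' _).substPoly _ hw, ?_⟩
  have htra (x : Rpi P) : tra S P r (algebraMap _ _ x) = algebraMap _ _ x :=
    RingHom.congr_fun (tra_comp_algebraMap S P r) x
  rw [natHom_substPoly S P r hw, map_ofCoeff]
  simp only [map_mul, htra, tra_frobSpi S P hi]
  rfl

end Comparison

/-! ## Divided powers of the uniformizer -/

section Arithmetic

theorem mul_two_mul_add_one_lt_pow {q : ℕ} (hq : 1 ≤ q) (k : ℕ) :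
    q * (2 * k + 1) < (q + 1) ^ (k + 1) := by
  induction k with
  | zero => simp
  | succ k ih =>
    rw [pow_succ]
    nlinarith [Nat.mul_le_mul_left q hq, Nat.zero_le (q * q * k)]

theorem pred_mul_add_le_of_pow_dvd {p k n M : ℕ} (hp : 2 ≤ p) (hk : p ^ k ∣ n + 1)
    (hM : 2 * M * (p - 1) ≤ n) : (p - 1) * (k + M) ≤ n := by
  obtain ⟨q, rfl⟩ : ∃ q, p = q + 1 := ⟨p - 1, by lia⟩
  rw [Nat.add_sub_cancel] at hM ⊢
  rcases le_or_gt k M with hkM | hkM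
  · nlinarith [Nat.mul_le_mul_left q hkM]
  · obtain ⟨j, rfl⟩ : ∃ j, k = j + 1 := ⟨k - 1, by lia⟩
    have hle : (q + 1) ^ (j + 1) ≤ n + 1 := Nat.le_of_dvd n.succ_pos hk
    have hlt := mul_two_mul_add_one_lt_pow (q := q) (by lia) j
    have hmono : q * (j + 1 + M) ≤ q * (2 * j + 1) := Nat.mul_le_mul_left q (by lia)
    lia

variable {p : ℕ} [Fact p.Prime] (P : EisensteinPoly p)

theorem exists_poly_sub_X_pow_eq_C_mul :
    ∃ Q : Polynomial ℤ_[p], IsUnit (Q.coeff 0) ∧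
      P.poly - Polynomial.X ^ P.poly.natDegree = Polynomial.C (p : ℤ_[p]) * Q := by
  obtain ⟨Q, hQ⟩ : Polynomial.C (p : ℤ_[p]) ∣ P.poly - Polynomial.X ^ P.poly.natDegree := by
    refine Polynomial.C_dvd_iff_dvd_coeff _ _ |>.2 fun i => ?_
    rw [Polynomial.coeff_sub, Polynomial.coeff_X_pow]
    rcases lt_trichotomy i P.poly.natDegree with hi | rfl | hi
    · rw [if_neg hi.ne, sub_zero]
      exact Ideal.mem_span_singleton.1 (P.eisenstein.mem hi)
    · rw [if_pos rfl, P.monic.coeff_natDegree, sub_self]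
      exact dvd_zero _
    · rw [if_neg hi.ne', Polynomial.coeff_eq_zero_of_natDegree_lt hi, sub_zero]
      exact dvd_zero _
  refine ⟨Q, ?_, hQ⟩
  by_contra hu
  have hdvd : (p : ℤ_[p]) ∣ Q.coeff 0 := by
    rw [← Ideal.mem_span_singleton, ← PadicInt.maximalIdeal_eq_span_p]
    exact hu
  have he : 0 ≠ P.poly.natDegree := by have := P.two_le; lia
  have h0 : P.poly.coeff 0 = p * Q.coeff 0 := by
    rw [← Polynomial.coeff_C_mul, ← hQ, Polynomial.coeff_sub, Polynomial.coeff_X_pow, if_neg he,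
      sub_zero]
  refine P.eisenstein.notMem ?_
  rw [h0, Ideal.span_singleton_pow, Ideal.mem_span_singleton, pow_two]
  exact mul_dvd_mul_left _ hdvd

theorem exists_isUnit_piR_pow_natDegree_eq :
    ∃ u z : Rpi P, IsUnit u ∧ piR P ^ P.poly.natDegree = p * (u + piR P * z) := by
  obtain ⟨Q, hQ0, hQ⟩ := exists_poly_sub_X_pow_eq_C_mul P
  let ρ : ℤ_[p] →+* Rpi P := (AdjoinRoot.of P.polyR).comp (fromZp p)
  have hroot : P.poly.eval₂ ρ (piR P) = 0 := by
    rw [← Polynomial.eval₂_map]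
    exact AdjoinRoot.eval₂_root _
  have hsplit : piR P * Q.divX.eval₂ ρ (piR P) + ρ (Q.coeff 0) = Q.eval₂ ρ (piR P) := by
    simpa only [Polynomial.eval₂_add, Polynomial.eval₂_mul, Polynomial.eval₂_X,
      Polynomial.eval₂_C] using congrArg (Polynomial.eval₂ ρ (piR P)) Q.X_mul_divX_add
  have heval : -piR P ^ P.poly.natDegree = p * Q.eval₂ ρ (piR P) := by
    have h := congrArg (Polynomial.eval₂ ρ (piR P)) hQ
    rwa [Polynomial.eval₂_sub, Polynomial.eval₂_mul, Polynomial.eval₂_C, Polynomial.eval₂_X_pow,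
      hroot, zero_sub, map_natCast] at h
  refine ⟨-ρ (Q.coeff 0), -Q.divX.eval₂ ρ (piR P), (hQ0.map ρ).neg, ?_⟩
  linear_combination -heval + (p : Rpi P) * hsplit

theorem p_dvd_piR_pow_natDegree : (p : Rpi P) ∣ piR P ^ P.poly.natDegree := by
  obtain ⟨u, z, -, h⟩ := exists_isUnit_piR_pow_natDegree_eq P
  exact ⟨_, h⟩

theorem piR_pow_natDegree_dvd_p : piR P ^ P.poly.natDegree ∣ (p : Rpi P) := by
  obtain ⟨u, z, hu, h⟩ := exists_isUnit_piR_pow_natDegree_eq P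
  suffices hk : ∀ k ≤ P.poly.natDegree, piR P ^ k ∣ (p : Rpi P) from hk _ le_rfl
  intro k hk
  induction k with
  | zero => exact pow_zero (piR P) ▸ one_dvd _
  | succ k ih =>
    have hpu : p * u = piR P ^ P.poly.natDegree - p * piR P * z := by linear_combination -h
    rw [← hu.dvd_mul_right, hpu, pow_succ]
    exact dvd_sub (pow_succ (piR P) k ▸ pow_dvd_pow _ hk)
      ((mul_dvd_mul_right (ih (by lia)) _).mul_right z)

theorem not_isUnit_piR : ¬ IsUnit (piR P) := by
  have hroot : P.polyR.eval₂ (WittVector.constantCoeff (R := AlgebraicClosure (ZMod p))) 0 = 0 := by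
    obtain ⟨y, hy⟩ := Ideal.mem_span_singleton.1
      (P.eisenstein.mem (Nat.zero_lt_two.trans_le P.two_le))
    rw [Polynomial.eval₂_at_zero, EisensteinPoly.polyR, Polynomial.coeff_map, hy, map_mul,
      map_natCast, map_mul, map_natCast, CharP.cast_eq_zero, zero_mul]
  intro h
  have h0 := h.map (AdjoinRoot.lift WittVector.constantCoeff 0 hroot)
  rw [piR, AdjoinRoot.lift_root] at h0
  exact not_isUnit_zero h0

theorem finiteMultiplicity_piR_p : FiniteMultiplicity (piR P) (p : Rpi P) := by
  refine ⟨P.poly.natDegree, fun hd => not_isUnit_piR P (isUnit_of_dvd_one ?_)⟩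
  have h := hd.trans (p_dvd_piR_pow_natDegree P)
  rw [pow_succ] at h
  exact (mul_dvd_mul_iff_left (pow_ne_zero _ (piR_ne_zero P))).1 (h.trans (mul_one _).symm.dvd)

theorem natDegree_le_of_le_vp_piR (h : 1 / ((p : ℚ) - 1) ≤ vp P (piR P)) :
    P.poly.natDegree ≤ p - 1 := by
  have hp := (Fact.out : p.Prime).one_lt
  have hle : P.poly.natDegree ≤ multiplicity (piR P) (p : Rpi P) :=
    (finiteMultiplicity_piR_p P).le_multiplicity_of_pow_dvd (piR_pow_natDegree_dvd_p P)
  have hpos : (0 : ℚ) < multiplicity (piR P) (p : Rpi P) := by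
    exact_mod_cast (Nat.zero_lt_two.trans_le P.two_le).trans_le hle
  have hp1 : (0 : ℚ) < (p : ℚ) - 1 := sub_pos.2 (by exact_mod_cast hp)
  rw [vp, multiplicity_self, Nat.cast_one, one_div_le_one_div hp1 hpos, ← Nat.cast_one,
    ← Nat.cast_sub hp.le] at h
  exact hle.trans (Nat.cast_le.1 h)

theorem isUnit_natCast_Rpi {m : ℕ} (hm : ¬ p ∣ m) : IsUnit (m : Rpi P) := by
  have h : IsUnit (m : ℤ_[p]) := PadicInt.isUnit_iff.2
    (PadicInt.norm_natCast_eq_one_iff.2 ((Fact.out : p.Prime).coprime_iff_not_dvd.2 hm))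
  rw [← map_natCast ((AdjoinRoot.of P.polyR).comp (fromZp p))]
  exact h.map _

variable {P} (hP : (p : Rpi P) ∣ piR P ^ (p - 1))
include hP

theorem succ_mul_pow_dvd_piR_pow {n M : ℕ} (hM : 2 * M * (p - 1) ≤ n) :
    ((n + 1 : ℕ) : Rpi P) * p ^ M ∣ piR P ^ n := by
  have hp : p.Prime := Fact.out
  obtain ⟨k, m, hm, hn⟩ := Nat.exists_eq_pow_mul_and_not_dvd n.succ_ne_zero p hp.ne_one
  have hpow : (p : Rpi P) ^ (k + M) ∣ piR P ^ n := calc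
    (p : Rpi P) ^ (k + M) ∣ (piR P ^ (p - 1)) ^ (k + M) := pow_dvd_pow_of_dvd hP _
    _ = piR P ^ ((p - 1) * (k + M)) := (pow_mul _ _ _).symm
    _ ∣ piR P ^ n := pow_dvd_pow _ (pred_mul_add_le_of_pow_dvd hp.two_le ⟨m, hn⟩ hM)
  have hassoc : ((n + 1 : ℕ) : Rpi P) * p ^ M = m * p ^ (k + M) := by
    rw [← Nat.succ_eq_add_one, hn]
    push_cast
    ring
  rwa [hassoc, (isUnit_natCast_Rpi P hm).mul_left_dvd]

theorem exists_piR_pow_div_natCast :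
    ∃ c : ℕ → Rpi P, c 0 = 0 ∧ (∀ n, ((n + 1 : ℕ) : Rpi P) * c (n + 1) = piR P ^ n) ∧
      ∀ m, ∀ᶠ n in atTop, (p : Rpi P) ^ m ∣ c n := by
  have hdvd (n : ℕ) : ((n + 1 : ℕ) : Rpi P) ∣ piR P ^ n := by
    simpa using succ_mul_pow_dvd_piR_pow hP (n := n) (M := 0) (by simp)
  choose c hc using hdvd
  refine ⟨fun n => n.casesOn 0 c, rfl, fun n => (hc n).symm, fun m => ?_⟩
  filter_upwards [eventually_gt_atTop (2 * m * (p - 1))] with n hn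
  obtain ⟨n, rfl⟩ : ∃ k, n = k + 1 := ⟨n - 1, by lia⟩
  have h := succ_mul_pow_dvd_piR_pow hP (Nat.le_of_lt_succ hn)
  have hne : ((n + 1 : ℕ) : Rpi P) ≠ 0 :=
    left_ne_zero_of_mul (hc n ▸ pow_ne_zero n (piR_ne_zero P))
  rw [hc n] at h
  exact (mul_dvd_mul_iff_left hne).1 h

end Arithmetic

/-! ## Evaluation at `T = 0` -/

section SetZero

theorem hasSubst_tailVar (r : ℕ) {J R : Type*} [Finite J] [CommRing R] :
    MvPowerSeries.HasSubst fun s : J × ℕ =>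
      ((tailVar r s : MvPolynomial (J × Fin r) R) : MvPowerSeries (J × Fin r) R) where
  const_coeff := by
    rintro ⟨j, _ | i⟩
    · simp [tailVar]
    · simp only [tailVar]
      split_ifs <;> simp
  coeff_zero d := by
    refine (Set.finite_univ.prod (Set.finite_Iic r)).subset ?_
    rintro ⟨j, _ | i⟩ hs
    · exact ⟨trivial, Nat.zero_le r⟩
    · by_contra h
      have hi : ¬ i < r := fun hi => h ⟨trivial, hi⟩
      exact hs (by simp [tailVar, hi])

theorem setZero_substPoly {J K R A : Type*} [Finite J] [Finite K] [CommRing R] [CommRing A] (r : ℕ)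
    (κ : R →+* A) {w : K → MvPolynomial (J × ℕ) R}
    (hw : ∀ k, MvPolynomial.constantCoeff (w k) = 0) (g : MvPowerSeries K A) :
    setZero r (substPoly κ w g) = substPoly κ (fun k => setZeroPoly r (w k)) g := by
  have hv : MvPowerSeries.HasSubst fun s : J × ℕ => (MvPolynomial.map κ (tailVar r s) :
      MvPowerSeries (J × Fin r) A) := by
    simpa only [map_tailVar] using hasSubst_tailVar r
  simpa only [map_tailVar, setZero, setZeroPoly] using subst_substPoly κ hw hv g

theorem rescale_const_ofCoeff {J A : Type*} [CommRing A] (x : A) (a : (J →₀ ℕ) → A) :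
    MvPowerSeries.rescale (fun _ => x) (ofCoeff a) = ofCoeff fun d => x ^ d.degree * a d := by
  ext d
  rw [MvPowerSeries.coeff_rescale, coeff_ofCoeff, coeff_ofCoeff, Finsupp.prod,
    Finset.prod_pow_eq_pow_sum, Finsupp.degree]
  rfl

theorem substPoly_setZeroPoly_frobVar {p : ℕ} [Fact p.Prime] (P : EisensteinPoly p) {i r : ℕ}
    (hi : i ≤ r) {J A : Type*} [Finite J] [CommRing A] (κ : Rpi P →+* A) (a : (J →₀ ℕ) → A) :
    substPoly (κ.comp (algebraMap (Rp p) (Rpi P)))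
        (fun j => setZeroPoly r (frobVar (baseP p) i j)) (ofCoeff a)
      = substPoly κ (frobTail P r i) (ofCoeff fun d => κ (piR P) ^ d.degree * a d) := by
  rw [← substPoly_map]
  simp only [← C_mul_frobTail P hi]
  rw [substPoly_C_mul κ (constantCoeff_frobTail P r i), rescale_const_ofCoeff]

end SetZero

/-! ## Iterated `p`-derivatives of power series -/

section Derivatives

theorem exists_pow_mul_iterate_mem_closure {A : Type*} [CommRing A] {p : ℕ} (hp : p ≠ 0)
    {φ : A →+* A} {δ : A → A} (hδ : ∀ x, p * δ x = φ x - x ^ p) (x : A) (r : ℕ) :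
    ∃ n : ℕ, (p : A) ^ n * δ^[r] x ∈ Subring.closure {y | ∃ i ≤ r, y = φ^[i] x} := by
  induction r with
  | zero =>
    refine ⟨0, ?_⟩
    rw [pow_zero, one_mul]
    exact Subring.subset_closure ⟨0, le_rfl, rfl⟩
  | succ r ih =>
    obtain ⟨n, hn⟩ := ih
    set y := δ^[r] x
    have hy : (p : A) ^ n * y ∈ Subring.closure {y | ∃ i ≤ r + 1, y = φ^[i] x} :=
      Subring.closure_mono (by rintro _ ⟨i, hi, rfl⟩; exact ⟨i, hi.trans r.le_succ, rfl⟩) hn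
    have hφy : φ (p ^ n * y) ∈ Subring.closure {y | ∃ i ≤ r + 1, y = φ^[i] x} := by
      suffices hle : Subring.closure {y | ∃ i ≤ r, y = φ^[i] x}
          ≤ (Subring.closure {y | ∃ i ≤ r + 1, y = φ^[i] x}).comap φ from hle hn
      rw [Subring.closure_le]
      rintro _ ⟨i, hi, rfl⟩
      exact Subring.subset_closure ⟨i + 1, Nat.succ_le_succ hi,
        (Function.iterate_succ_apply' _ _ _).symm⟩
    have hδy : (p : A) ^ (n * p + 1) * δ y
        = p ^ (n * p - n) * φ (p ^ n * y) - (p ^ n * y) ^ p := by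
      have hle : n ≤ n * p := Nat.le_mul_of_pos_right n (Nat.pos_of_ne_zero hp)
      rw [pow_succ, mul_assoc, hδ, map_mul, map_pow, map_natCast, ← mul_assoc, ← pow_add,
        Nat.sub_add_cancel hle, mul_pow, ← pow_mul, mul_sub]
    refine ⟨n * p + 1, ?_⟩
    rw [Function.iterate_succ_apply', hδy]
    exact sub_mem (mul_mem (pow_mem (natCast_mem _ p) _) hφy) (pow_mem hy p)

variable {p : ℕ} [Fact p.Prime] {S : Type u}

/-- `PhiSeries` as a ring homomorphism. -/
def phiSeriesHom (p : ℕ) [Fact p.Prime] (J : Type*) (S : Type u) :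
    MvPowerSeries (J × ℕ) (MvPolynomial (S × ℕ) (Rp p)) →+*
      MvPowerSeries (J × ℕ) (MvPolynomial (S × ℕ) (Rp p)) :=
  (MvPowerSeries.substAlgHom (R := MvPolynomial (S × ℕ) (Rp p))
    (hasSubst_PhiSeries (p := p) (J := J))).toRingHom.comp
      (MvPowerSeries.map (Phi (baseP p) (baseP p).ϖ))

theorem coe_phiSeriesHom (J : Type*) : ⇑(phiSeriesHom p J S) = PhiSeries := by
  funext f
  rw [phiSeriesHom, RingHom.comp_apply, AlgHom.toRingHom_eq_coe, RingHom.coe_coe,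
    MvPowerSeries.coe_substAlgHom, PhiSeries]

theorem coe_map_C_Phi_X {J : Type*} (s : J × ℕ) :
    (MvPolynomial.map (MvPolynomial.C (σ := S × ℕ))
        (Phi (baseP p) (baseP p).ϖ (MvPolynomial.X s)) :
        MvPowerSeries (J × ℕ) (MvPolynomial (S × ℕ) (Rp p)))
      = MvPowerSeries.X s ^ p + (p : MvPowerSeries (J × ℕ) (MvPolynomial (S × ℕ) (Rp p))) *
          MvPowerSeries.X (s.1, s.2 + 1) := by
  have hp : ((p : MvPolynomial (J × ℕ) (MvPolynomial (S × ℕ) (Rp p))) :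
      MvPowerSeries (J × ℕ) (MvPolynomial (S × ℕ) (Rp p))) = p :=
    map_natCast MvPolynomial.coeToMvPowerSeries.ringHom p
  simp [Phi, baseP, hp]

theorem PhiSeries_substPoly {J K : Type*} [Finite K] {w : K → MvPolynomial (J × ℕ) (Rp p)}
    (hw : ∀ k, MvPolynomial.constantCoeff (w k) = 0)
    (g : MvPowerSeries K (MvPolynomial (S × ℕ) (Rp p))) :
    PhiSeries (substPoly MvPolynomial.C w g)
      = substPoly MvPolynomial.C (fun k => Phi (baseP p) (baseP p).ϖ (w k))
          (g.map (Phi (baseP p) (baseP p).ϖ)) := by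
  have hC : (Phi (baseP p) (baseP p).ϖ (ι := S)).comp MvPolynomial.C
      = MvPolynomial.C.comp (baseP p).φ := by
    ext1 c
    simp [Phi]
  have hw' (k : K) : MvPolynomial.constantCoeff (MvPolynomial.map (baseP p).φ (w k)) = 0 := by
    rw [MvPolynomial.constantCoeff_map, hw, map_zero]
  rw [PhiSeries, map_substPoly _ hw, hC, ← substPoly_map]
  simp only [← coe_map_C_Phi_X]
  rw [subst_substPoly _ hw' (by simpa only [coe_map_C_Phi_X] using hasSubst_PhiSeries)]
  simp only [aeval_Phi_X_map]

variable [CommRing S]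

theorem PhiSeries_iterate_liftSeries {J : Type*} [Finite J] (f : MvPowerSeries J S) (i : ℕ) :
    PhiSeries^[i] (liftSeries p f) = substPoly MvPolynomial.C (frobVar (baseP p) i)
      (ofCoeff fun d => frobVar (baseP p) i (MvPowerSeries.coeff d f)) := by
  induction i with
  | zero => simp [liftSeries, ofCoeff, substPoly, frobVar_zero]
  | succ i ih =>
    rw [Function.iterate_succ_apply', ih, PhiSeries_substPoly (constantCoeff_frobVar _ i),
      map_ofCoeff]
    simp only [← frobVar_succ]

variable [Algebra (Rp p) S] (P : EisensteinPoly p)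

theorem toSp_comp_C (r : ℕ) :
    (toSp S r).comp MvPolynomial.C = algebraMap (Rp p) (Sp p S r) := by
  ext1 c
  exact congrArg (algebraMap (JetP p S r) (Sp p S r)) ((toJet (baseP p) (relP p S) r).commutes c)

/-- The ring homomorphism `g ↦ g|_{T = 0}`, with values in series over `R_π ⊗ S^r_p`. -/
def evalZero (S : Type u) [CommRing S] [Algebra (Rp p) S] (P : EisensteinPoly p) (r : ℕ)
    (J : Type*) [Finite J] :
    MvPowerSeries (J × ℕ) (MvPolynomial (S × ℕ) (Rp p)) →+*
      MvPowerSeries (J × Fin r) (SpTensor S P r) :=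
  (MvPowerSeries.map (inclTensor S P r)).comp
    ((MvPowerSeries.substAlgHom (R := Sp p S r) (hasSubst_tailVar r)).toRingHom.comp
      (MvPowerSeries.map (toSp S r)))

theorem evalZero_apply (r : ℕ) {J : Type*} [Finite J]
    (g : MvPowerSeries (J × ℕ) (MvPolynomial (S × ℕ) (Rp p))) :
    evalZero S P r J g = (setZero r (g.map (toSp S r))).map (inclTensor S P r) := by
  rw [evalZero, RingHom.comp_apply, RingHom.comp_apply, AlgHom.toRingHom_eq_coe, RingHom.coe_coe,
    MvPowerSeries.coe_substAlgHom, setZero]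

theorem evalZero_PhiSeries_iterate {i r : ℕ} (hi : i ≤ r) {J : Type*} [Finite J]
    (f : MvPowerSeries J S) :
    evalZero S P r J (PhiSeries^[i] (liftSeries p f))
      = substPoly (algebraMap (Rpi P) (SpTensor S P r)) (frobTail P r i) (ofCoeff fun d =>
          algebraMap _ _ (piR P ^ d.degree) *
            inclTensor S P r (frobSp S r i (MvPowerSeries.coeff d f))) := by
  have hw := constantCoeff_frobVar (baseP p) i (ι := J)
  have hw' (j : J) : MvPolynomial.constantCoeff (setZeroPoly r (frobVar (baseP p) i j)) = 0 := by
    rw [constantCoeff_setZeroPoly, hw]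
  rw [PhiSeries_iterate_liftSeries, evalZero_apply, map_substPoly _ hw, toSp_comp_C,
    setZero_substPoly r _ hw, map_substPoly _ hw', inclTensor_comp_algebraMap, map_ofCoeff,
    map_ofCoeff, substPoly_setZeroPoly_frobVar P hi]
  simp only [map_pow]
  rfl

theorem evalZero_PhiSeries_iterate_mem_natHomImage {i r : ℕ} (hi : i ≤ r) {J : Type*} [Finite J]
    (f : MvPowerSeries J S) :
    evalZero S P r J (PhiSeries^[i] (liftSeries p f)) ∈ natHomImage S P r J := by
  rw [evalZero_PhiSeries_iterate P hi]
  refine substPoly_frobTail_mem_natHomImage S P hi (c := fun n => piR P ^ n) (fun m => ?_) _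
  filter_upwards [eventually_ge_atTop (P.poly.natDegree * m)] with n hn
  calc (p : Rpi P) ^ m ∣ (piR P ^ P.poly.natDegree) ^ m :=
        pow_dvd_pow_of_dvd (p_dvd_piR_pow_natDegree P) m
    _ = piR P ^ (P.poly.natDegree * m) := (pow_mul _ _ _).symm
    _ ∣ piR P ^ n := pow_dvd_pow _ hn

theorem exists_pow_mul_jetSeries_mem_natHomImage (r : ℕ) {J : Type*} [Finite J]
    (f : MvPowerSeries J S) :
    ∃ n : ℕ, 1 ≤ n ∧ (p : MvPowerSeries (J × Fin r) (SpTensor S P r)) ^ n *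
      (jetSeries p r f).map (inclTensor S P r) ∈ natHomImage S P r J := by
  have hδ (g : MvPowerSeries (J × ℕ) (MvPolynomial (S × ℕ) (Rp p))) :
      p * deltaSeries g = phiSeriesHom p J S g - g ^ p := by
    rw [coe_phiSeriesHom, deltaSeries_spec]
  obtain ⟨n, hn⟩ := exists_pow_mul_iterate_mem_closure (Fact.out : p.Prime).ne_zero hδ
    (liftSeries p f) r
  have hclosure : Subring.closure {g | ∃ i ≤ r, g = (phiSeriesHom p J S)^[i] (liftSeries p f)}
      ≤ (natHomImage S P r J).comap (evalZero S P r J) := by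
    rw [Subring.closure_le, coe_phiSeriesHom]
    rintro _ ⟨i, hi, rfl⟩
    exact evalZero_PhiSeries_iterate_mem_natHomImage P hi f
  have hjet : (p : MvPowerSeries (J × Fin r) (SpTensor S P r)) ^ n *
      (jetSeries p r f).map (inclTensor S P r) ∈ natHomImage S P r J := by
    have h := hclosure hn
    rwa [Subring.mem_comap, map_mul, map_pow, map_natCast, evalZero_apply] at h
  refine ⟨n + 1, n.succ_pos, ?_⟩
  rw [pow_succ', mul_assoc]
  exact mul_mem (natCast_mem _ p) hjet

end Derivatives

/-! ## The logarithm -/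

section Logarithm

theorem ratMap_toRat {A B : Type*} [CommRing A] [CommRing B] (f : A →+* B) (a : A) :
    ratMap f (toRat A a) = toRat B (f a) :=
  Algebra.TensorProduct.map_tmul (AlgHom.id ℤ ℚ) f.toIntAlgHom 1 a

/-- The `n`-th coefficient of the invariant differential `dT / (∂F/∂X)(0, T)` of a formal group law,
so that the logarithm is `∑ diffCoeff F (n - 1) T^n / n`. -/
def diffCoeff {S : Type*} [CommRing S] (F : FormalGroup S) (n : ℕ) : S :=
  PowerSeries.coeff n (PowerSeries.invOfUnit (PowerSeries.mk fun k =>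
    MvPowerSeries.coeff (Finsupp.single 0 1 + Finsupp.single 1 k) F.toPowerSeries) 1)

theorem map_formalLog {S A : Type*} [CommRing S] [CommRing A] (F : FormalGroup S) (f : S →+* A) :
    (formalLog F).map (ratMap f) = (ofCoeff fun d : Unit →₀ ℕ =>
      (1 / d.degree : ℚ) • toRat A (f (diffCoeff F (d.degree - 1))) :
        MvPowerSeries Unit (RatTensor A)) := by
  refine PowerSeries.ext fun n => ?_
  rw [PowerSeries.coeff_map, formalLog, PowerSeries.coeff_mk, map_rat_smul, ratMap_toRat]
  refine Eq.trans ?_ (coeff_ofCoeff _ (Finsupp.single () n)).symm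
  rw [Finsupp.degree_single]
  rfl

variable {p : ℕ} [Fact p.Prime] {S : Type u} [CommRing S] [Algebra (Rp p) S]
  (P : EisensteinPoly p)

/-- The homomorphism `R_π → (R_π ⊗ S^r_p) ⊗ ℚ`. -/
abbrev toRatTensor (S : Type u) [CommRing S] [Algebra (Rp p) S] (r : ℕ) :
    Rpi P →+* RatTensor (SpTensor S P r) :=
  (toRat (SpTensor S P r)).comp (algebraMap (Rpi P) (SpTensor S P r))

theorem ratMap_inclTensor_comp (r : ℕ) :
    (ratMap (inclTensor S P r)).comp ((toRat (Sp p S r)).comp (algebraMap (Rp p) (Sp p S r)))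
      = (toRatTensor P S r).comp (algebraMap (Rp p) (Rpi P)) := by
  rw [RingHom.comp_assoc, ← inclTensor_comp_algebraMap, ← RingHom.comp_assoc, ← RingHom.comp_assoc]
  congr 1

theorem Lpi_eq_substPoly (F : FormalGroup S) (r : ℕ) :
    Lpi F P r = substPoly (toRatTensor P S r) (frobTail P r r)
      (MvPowerSeries.C (toRatTensor P S r (pDivPi P)) * (1 / p : ℚ) • ofCoeff fun d : Unit →₀ ℕ =>
        toRatTensor P S r (piR P) ^ d.degree * (1 / d.degree : ℚ) •
          toRat _ (inclTensor S P r (frobSp S r r (diffCoeff F (d.degree - 1))))) := by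
  have hw := constantCoeff_frobVar (baseP p) r (ι := Unit)
  have hw' (j : Unit) : MvPolynomial.constantCoeff (setZeroPoly r (frobVar (baseP p) r j)) = 0 := by
    rw [constantCoeff_setZeroPoly, hw]
  have hsubst (g : PowerSeries (RatTensor (Sp p S r))) : PowerSeries.subst (phiT p S r) g
      = substPoly ((toRat (Sp p S r)).comp (algebraMap _ _)) (frobVar (baseP p) r) g := rfl
  have hfrob := constantCoeff_frobTail P r r (J := Unit)
  rw [Lpi, Lp, map_rat_smul, hsubst, setZero_substPoly r _ hw, map_substPoly _ hw',
    ratMap_inclTensor_comp, map_formalLog, map_ofCoeff, substPoly_setZeroPoly_frobVar P le_rfl,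
    smul_substPoly _ hfrob, ← C_mul_substPoly _ hfrob]
  simp only [map_rat_smul, ratMap_toRat, phiSp_apply]
  rfl

theorem map_pDivPi_mul_divided_pow {D : Type*} [CommRing D] [Algebra ℚ D] (κ : Rpi P →+* D)
    {c : ℕ → Rpi P} (h0 : c 0 = 0)
    (hc : ∀ n, ((n + 1 : ℕ) : Rpi P) * c (n + 1) = piR P ^ n) (n : ℕ) (t : D) :
    κ (pDivPi P) * (1 / p : ℚ) • (κ (piR P) ^ n * (1 / n : ℚ) • t) = κ (c n) * t := by
  rcases n with _ | n
  · simp [h0]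
  have hp : algebraMap ℚ D (1 / p) * p = 1 := by
    rw [← map_natCast (algebraMap ℚ D), ← map_mul,
      one_div_mul_cancel (Nat.cast_ne_zero.2 (Fact.out : p.Prime).ne_zero), map_one]
  have hn : algebraMap ℚ D (1 / (n + 1 : ℕ)) * (n + 1 : ℕ) = 1 := by
    rw [← map_natCast (algebraMap ℚ D), ← map_mul,
      one_div_mul_cancel (Nat.cast_ne_zero.2 n.succ_ne_zero), map_one]
  have hπ : κ (piR P) * κ (pDivPi P) = p := by rw [← map_mul, piR_mul_pDivPi, map_natCast]
  have hcn : ((n + 1 : ℕ) : D) * κ (c (n + 1)) = κ (piR P) ^ n := by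
    rw [← map_natCast κ, ← map_mul, hc, map_pow]
  rw [Algebra.smul_def, Algebra.smul_def, pow_succ, ← hcn]
  calc κ (pDivPi P) * (algebraMap ℚ D (1 / p) * ((n + 1 : ℕ) * κ (c (n + 1)) * κ (piR P) *
        (algebraMap ℚ D (1 / (n + 1 : ℕ)) * t)))
      = (algebraMap ℚ D (1 / p) * (κ (piR P) * κ (pDivPi P))) *
          (algebraMap ℚ D (1 / (n + 1 : ℕ)) * (n + 1 : ℕ)) * (κ (c (n + 1)) * t) := by ring
    _ = κ (c (n + 1)) * t := by rw [hπ, hp, hn, one_mul, one_mul]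

theorem exists_mem_natHomImage_map_toRat_eq_Lpi {P : EisensteinPoly p}
    (hP : (p : Rpi P) ∣ piR P ^ (p - 1)) (F : FormalGroup S) (r : ℕ) :
    ∃ L ∈ natHomImage S P r Unit, L.map (toRat (SpTensor S P r)) = Lpi F P r := by
  obtain ⟨c, h0, hc, hlim⟩ := exists_piR_pow_div_natCast hP
  refine ⟨_, substPoly_frobTail_mem_natHomImage S P le_rfl hlim
    fun d => diffCoeff F (d.degree - 1), ?_⟩
  rw [Lpi_eq_substPoly, map_substPoly _ (constantCoeff_frobTail P r r), map_ofCoeff]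
  congr 1
  refine MvPowerSeries.ext fun d => ?_
  rw [MvPowerSeries.coeff_C_mul, map_rat_smul, coeff_ofCoeff, coeff_ofCoeff, map_mul]
  exact (map_pDivPi_mul_divided_pow P (toRatTensor P S r) h0 hc d.degree _).symm

end Logarithm

end PiJet

end

theorem proposition2p10_general (p : ℕ) [Fact p.Prime] (P : PiJet.EisensteinPoly p)
    (S : Type*) [CommRing S] [Algebra (PiJet.Rp p) S] {J : Type*} [Finite J]
    (f : MvPowerSeries J S) (F : FormalGroup S) (r : ℕ) :
    (∃ n : ℕ, 1 ≤ n ∧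
      ∃ G : MvPowerSeries (J × Fin r) (PiJet.Spi S P r), PiJet.IsRestricted p G ∧
        PiJet.natHom S P r J G = (p : MvPowerSeries (J × Fin r) (PiJet.SpTensor S P r)) ^ n *
          (PiJet.jetSeries p r f).map (PiJet.inclTensor S P r)) ∧
    (1 / ((p : ℚ) - 1) ≤ PiJet.vp P (PiJet.piR P) →
      ∃ G : MvPowerSeries (Unit × Fin r) (PiJet.Spi S P r), PiJet.IsRestricted p G ∧
        (PiJet.natHom S P r Unit G).map (PiJet.toRat (PiJet.SpTensor S P r)) =
          PiJet.Lpi F P r) := by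
  refine ⟨PiJet.exists_pow_mul_jetSeries_mem_natHomImage P r f, fun h => ?_⟩
  have hP : (p : PiJet.Rpi P) ∣ PiJet.piR P ^ (p - 1) :=
    (PiJet.p_dvd_piR_pow_natDegree P).trans
      (pow_dvd_pow _ (PiJet.natDegree_le_of_le_vp_piR P h))
  obtain ⟨_, ⟨G, hG, rfl⟩, hL⟩ := PiJet.exists_mem_natHomImage_map_toRat_eq_Lpi hP F r
  exact ⟨G, hG, hL⟩

theorem proposition2p10 (p : ℕ) [Fact p.Prime] (hp : 5 ≤ p) (P : PiJet.EisensteinPoly p)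
    (S : Type*) [CommRing S] [Algebra (PiJet.Rp p) S] [Algebra.Smooth (PiJet.Rp p) S]
    (F : FormalGroup S) (r : ℕ) (hr : 1 ≤ r) :
    (∃ n : ℕ, 1 ≤ n ∧
      ∃ G : MvPowerSeries (Fin 2 × Fin r) (PiJet.Spi S P r), PiJet.IsRestricted p G ∧
        PiJet.natHom S P r (Fin 2) G =
          (p : MvPowerSeries (Fin 2 × Fin r) (PiJet.SpTensor S P r)) ^ n *
            (PiJet.jetSeries p r F.toPowerSeries).map (PiJet.inclTensor S P r)) ∧
    (1 / ((p : ℚ) - 1) ≤ PiJet.vp P (PiJet.piR P) →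
      ∃ G : MvPowerSeries (Unit × Fin r) (PiJet.Spi S P r), PiJet.IsRestricted p G ∧
        (PiJet.natHom S P r Unit G).map (PiJet.toRat (PiJet.SpTensor S P r)) =
          PiJet.Lpi F P r) :=
  proposition2p10_general p P S F.toPowerSeries F r
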